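/- **Setting.** Let $\Omega$ be the space of continuous paths $\omega:\mathbb R_+\to\mathbb R$ with $\omega_0=0$, with canonical process $B$, canonical filtration $\mathbb F=(\mathcal F_t)_{t\ge0}$, $\mathcal F_t=\sigma(B_u,u\le t)$, $\mathcal F=\bigvee_t\mathcal F_t$, and Wiener measure $\mathbb P_0$. Let $\overline\Omega=\Omega\times\mathbb R_+$ with canonical element $(B,T)$, $B(\omega,\theta)=\omega$, $T(\omega,\theta)=\theta$, and filtration $\overline{\mathbb F}=(\overline{\mathcal F}_t)_{t\ge0}$, $\overline{\mathcal F}_t=\sigma(B_u,u\le t)\vee\sigma(\{T\le u\},u\le t)$, $\overline{\mathcal F}=\bigvee_t\overline{\mathcal F}_t$; put $\overline{\mathcal F}^0=\sigma(B_t,t\ge0)$ on $\overline\Omega$. Elements of $\overline\Omega$ are written $\bar\omega=(\omega,\theta)$, $\bar\omega'=(\omega',\theta')$. Let $$(\omega\otimes_\theta\omega')_t=\omega_t\mathbf 1_{\{t<\theta\}}+(\omega_\theta+\omega'_{t-\theta})\mathbf 1_{\{t\ge\theta\}},\qquad \bar\omega\otimes\bar\omega'=(\omega\otimes_\theta\omega',\theta+\theta').$$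 Let $\mu$ be a centered probability measure on $\mathbb R$ with finite first moment, let $\xi:\overline\Omega\to\mathbb R$ be measurable and non-anticipative, i.e. $\xi(\omega,\theta)=\xi(\omega_{\theta\wedge\cdot},\theta)$, and let $\overline{\mathbb P}^*$ be a probability measure on $(\overline\Omega,\overline{\mathcal F})$ under which $B$ is an $\overline{\mathbb F}$-Brownian motion, $B_{T\wedge\cdot}$ is uniformly integrable and $B_T\sim\mu$ (for instance, one that maximizes $\mathbb E[\xi]$ among these measures). Let $(\overline{\mathbb P}^*_\omega)_{\omega\in\Omega}$ be any family such that $(\omega,\theta)\mapsto\overline{\mathbb P}^*_{\omega}$ is a regular conditional probability distribution of $\overline{\mathbb P}^*$ with respect to $\overline{\mathcal F}^0$ and $\overline{\mathbb P}^*_\omega[B=\omega]=1$ for all $\omega\in\Omega$. For $t\ge0$ let $\mathbb P_0^{t,\omega}$ be the law of $\omega\otimes_tB$ under $\mathbb P_0$. For $\bar\omega=(\omega,\theta)$ and $\overline A\in\overline{\mathcal F}$ put $$\overline{\mathbb Q}^1_{\bar\omega}[\overline A]=\int_\Omega\overline{\mathbb P}^*_{\omega\otimes_\theta\omega'}(\overline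 A)\,\mathbb P_0(d\omega'),$$ $$\overline{\mathbb Q}^2_{\bar\omega}=\begin{cases}\overline{\mathbb Q}^1_{\bar\omega}[\,\cdot\mid T>\theta]&\text{if }\overline{\mathbb Q}^1_{\bar\omega}[T>\theta]>0,\\ \mathbb P_0^{\theta,\omega}\otimes\delta_\theta&\text{otherwise,}\end{cases}$$ and let $\overline{\mathbb Q}^*_{\bar\omega}$ be the law of $(B_{\theta+\cdot}-B_\theta,\,T-\theta)$ under $\overline{\mathbb Q}^2_{\bar\omega}$, i.e. $\overline{\mathbb Q}^*_{\bar\omega}[\overline A]=\overline{\mathbb Q}^2_{\bar\omega}[\{\bar\omega\otimes\bar\omega'':\bar\omega''\in\overline A\}]$. Expectations are defined by $\mathbb E[\zeta]=\mathbb E[\zeta^+]-\mathbb E[\zeta^-]\in[-\infty,\infty]$ with $\infty-\infty=-\infty$. Let $$\mathrm{SG}^*=\Big\{(\bar\omega,\bar\omega')\in\overline\Omega\times\overline\Omega:\ \omega_\theta=\omega'_{\theta'},\ \ \xi(\bar\omega)+\mathbb E^{\overline{\mathbb Q}^*_{\bar\omega}}[\xi(\bar\omega'\otimes\cdot)]>\mathbb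 E^{\overline{\mathbb Q}^*_{\bar\omega}}[\xi(\bar\omega\otimes\cdot)]+\xi(\bar\omega')\Big\}.$$ **Claim.** (i) $\mathrm{SG}^*$ is $\overline{\mathcal F}_T\otimes\overline{\mathcal F}_T$-measurable. (ii) Let $\tau$ be an $\overline{\mathbb F}$-stopping time with $\tau\le T$. Then there is an $\mathbb F$-stopping time $\tau_0:\Omega\to[0,\infty]$ with $\tau(\bar\omega)=\tau_0(\omega)\wedge\theta$ for all $\bar\omega=(\omega,\theta)\in\overline\Omega$. Moreover the family $$\widehat{\mathbb P}_{\bar\omega}=\mathbf 1_{\{\tau(\bar\omega)<\theta\}}\,\overline{\mathbb Q}^2_{(\omega,\tau(\bar\omega))}+\mathbf 1_{\{\tau(\bar\omega)=\theta\}}\,\mathbb P_0^{\tau(\bar\omega),\omega}\otimes\delta_\theta$$ is a family of regular conditional probability measures of $\overline{\mathbb P}^*$ with respect to $\overline{\mathcal F}_\tau$: each $\widehat{\mathbb P}_{\bar\omega}$ is a probability measure, $\bar\omega\mapsto\widehat{\mathbb P}_{\bar\omega}$ is $\overline{\mathcal F}_\tau$-measurable, and for every bounded $\overline{\mathcal F}$-measurable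 $\zeta$ one has $\mathbb E^{\overline{\mathbb P}^*}[\zeta\mid\overline{\mathcal F}_\tau](\bar\omega)=\widehat{\mathbb P}_{\bar\omega}[\zeta]$ for $\overline{\mathbb P}^*$-a.e. $\bar\omega$. -/

import Mathlib

open MeasureTheory ProbabilityTheory
open scoped NNReal ENNReal

noncomputable section

namespace SkorokhodEmbedding

/-! ### The canonical space -/

/-- The canonical space `Ω` of continuous paths `ω : ℝ₊ → ℝ` with `ω 0 = 0`. -/
def PathSpace : Type := {ω : C(ℝ≥0, ℝ) // ω 0 = 0}

namespace PathSpace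

instance : CoeFun PathSpace (fun _ => ℝ≥0 → ℝ) := ⟨fun ω => ω.1⟩

/-- `𝓕 = ⋁ₜ σ(B_t)`, the σ-field generated by the canonical process (it is also the Borel σ-field
of the topology of compact convergence). -/
instance : MeasurableSpace PathSpace :=
  ⨆ t : ℝ≥0, MeasurableSpace.comap (fun ω : PathSpace => ω t) inferInstance

protected lemma continuous (ω : PathSpace) : Continuous (fun t => ω t) := ω.1.continuous

lemma apply_zero (ω : PathSpace) : ω 0 = 0 := ω.2

lemma measurable_apply (t : ℝ≥0) : Measurable (fun ω : PathSpace => ω t) :=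
  Measurable.of_comap_le (le_iSup (fun s : ℝ≥0 =>
    MeasurableSpace.comap (fun ω : PathSpace => ω s) inferInstance) t)

/-- The stopped path `ω_{t ∧ ·}`. -/
def stopAt (ω : PathSpace) (t : ℝ≥0) : PathSpace :=
  ⟨⟨fun u => ω (min t u), ω.continuous.comp (continuous_const.min continuous_id)⟩, by
    show ω (min t 0) = 0
    rw [min_eq_right (zero_le : (0 : ℝ≥0) ≤ t), ω.apply_zero]⟩

lemma continuous_concat (ω : PathSpace) (θ : ℝ≥0) (ω' : PathSpace) :
    Continuous (fun t : ℝ≥0 => if t < θ then ω t else ω θ + ω' (t - θ)) := by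
  have h : (fun t : ℝ≥0 => if t < θ then ω t else ω θ + ω' (t - θ))
      = fun t => ω (min t θ) + ω' (t - θ) := by
    funext t
    split_ifs with ht
    · rw [min_eq_left ht.le, tsub_eq_zero_of_le ht.le, ω'.apply_zero, add_zero]
    · rw [min_eq_right (not_lt.1 ht)]
  rw [h]
  exact (ω.continuous.comp (continuous_id.min continuous_const)).add
    (ω'.continuous.comp (continuous_id.sub continuous_const))

/-- The concatenation `ω ⊗_θ ω'`: follow `ω` before time `θ`, then the increments of `ω'`. -/
def concat (ω : PathSpace) (θ : ℝ≥0) (ω' : PathSpace) : PathSpace :=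
  ⟨⟨fun t => if t < θ then ω t else ω θ + ω' (t - θ), continuous_concat ω θ ω'⟩, by
    show (if (0 : ℝ≥0) < θ then ω 0 else ω θ + ω' (0 - θ)) = 0
    split_ifs with h
    · exact ω.apply_zero
    · have hθ : θ = 0 := le_antisymm (not_lt.1 h) zero_le
      rw [hθ, tsub_zero, ω.apply_zero, ω'.apply_zero, add_zero]⟩

/-- The path restarted at time `θ`, `t ↦ ω (θ + t) - ω θ`. -/
def restart (ω : PathSpace) (θ : ℝ≥0) : PathSpace :=
  ⟨⟨fun t => ω (θ + t) - ω θ,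
    (ω.continuous.comp (continuous_const.add continuous_id)).sub continuous_const⟩, by
    show ω (θ + 0) - ω θ = 0
    rw [add_zero, sub_self]⟩

/-- The canonical filtration `𝓕_t = σ(B_u, u ≤ t)` on `Ω`. -/
def filtration : Filtration ℝ≥0 (inferInstance : MeasurableSpace PathSpace) where
  seq t := ⨆ u : ℝ≥0, ⨆ _ : u ≤ t,
    MeasurableSpace.comap (fun ω : PathSpace => ω u) inferInstance
  mono' _ _ hst := iSup₂_le fun u hu => le_iSup₂_of_le u (hu.trans hst) le_rfl
  le' _ := iSup₂_le fun u _ => (measurable_apply u).comap_le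

end PathSpace

/-- A Wiener measure on `Ω`: the canonical process is a Brownian motion. This determines the
measure. -/
def IsWienerMeasure (P₀ : Measure PathSpace) : Prop :=
  IsBrownianReal (fun (t : ℝ≥0) (ω : PathSpace) => ω t) P₀

/-! ### The enlarged canonical space -/

/-- The enlarged space `Ω × ℝ₊`, with the product σ-field. Its canonical element is `(B, T)`,
with `B (ω, θ) = ω` and `T (ω, θ) = θ`. -/
abbrev EnlargedSpace : Type := PathSpace × ℝ≥0

/-- The concatenation `(ω, θ) ⊗ (ω', θ') = (ω ⊗_θ ω', θ + θ')`. -/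
def concatBar (w w' : EnlargedSpace) : EnlargedSpace := (w.1.concat w.2 w'.1, w.2 + w'.2)

/-- `ξ` is non-anticipative: `ξ (ω, θ) = ξ (ω_{θ ∧ ·}, θ)`. -/
def NonAnticipative (ξ : EnlargedSpace → ℝ) : Prop :=
  ∀ (ω : PathSpace) (θ : ℝ≥0), ξ (ω, θ) = ξ (ω.stopAt θ, θ)

/-- The canonical filtration `σ(B_u, u ≤ t) ∨ σ({T ≤ u}, u ≤ t)` of the enlarged space. -/
def enlargedFiltration : Filtration ℝ≥0 (inferInstance : MeasurableSpace EnlargedSpace) where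
  seq t := (⨆ u : ℝ≥0, ⨆ _ : u ≤ t,
      MeasurableSpace.comap (fun w : EnlargedSpace => w.1 u) inferInstance) ⊔
    MeasurableSpace.generateFrom {A | ∃ u : ℝ≥0, u ≤ t ∧ A = {w : EnlargedSpace | w.2 ≤ u}}
  mono' s t hst := by
    refine sup_le_sup (iSup₂_le fun u hu => le_iSup₂_of_le u (hu.trans hst) le_rfl)
      (MeasurableSpace.generateFrom_mono ?_)
    rintro A ⟨u, hu, rfl⟩
    exact ⟨u, hu.trans hst, rfl⟩
  le' t := by
    refine sup_le (iSup₂_le fun u _ =>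
      ((PathSpace.measurable_apply u).comp measurable_fst).comap_le)
      (MeasurableSpace.generateFrom_le ?_)
    rintro A ⟨u, -, rfl⟩
    exact measurableSet_le measurable_snd measurable_const

/-- The canonical time `T` is a stopping time of the enlarged filtration. -/
lemma isStoppingTime_T :
    IsStoppingTime enlargedFiltration (fun w : EnlargedSpace => (w.2 : WithTop ℝ≥0)) := by
  intro t
  have h : MeasurableSet[MeasurableSpace.generateFrom
      {A | ∃ u : ℝ≥0, u ≤ t ∧ A = {w : EnlargedSpace | w.2 ≤ u}}]
      {w : EnlargedSpace | w.2 ≤ t} :=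
    MeasurableSpace.measurableSet_generateFrom ⟨t, le_rfl, rfl⟩
  have h' := (le_sup_right : _ ≤ enlargedFiltration t) _ h
  simp only [WithTop.coe_le_coe]
  exact h'

/-- The σ-field of the events prior to `T`. -/
abbrev sigmaT : MeasurableSpace EnlargedSpace := isStoppingTime_T.measurableSpace

/-- The σ-field `σ(B_t, t ≥ 0)` on the enlarged space. -/
abbrev sigmaB : MeasurableSpace EnlargedSpace :=
  ⨆ t : ℝ≥0, MeasurableSpace.comap (fun w : EnlargedSpace => w.1 t) inferInstance

/-! ### Embeddings -/

/-- `W` is a Brownian motion (started at `0`) with respect to the filtration `𝔽` under `P`. -/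
structure IsFilteredBrownianMotion {X : Type*} {m : MeasurableSpace X}
    (𝔽 : Filtration ℝ≥0 m) (W : ℝ≥0 → X → ℝ) (P : Measure X) : Prop where
  adapted : ∀ t, Measurable[𝔽 t] (W t)
  zero : ∀ᵐ x ∂P, W 0 x = 0
  continuous : ∀ᵐ x ∂P, Continuous (fun t => W t x)
  law_increment : ∀ s t : ℝ≥0, s ≤ t →
    HasLaw (fun x => W t x - W s x) (gaussianReal 0 (t - s)) P
  indep_increment : ∀ s t : ℝ≥0, s ≤ t →
    Indep (MeasurableSpace.comap (fun x => W t x - W s x) inferInstance) (𝔽 s) P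

/-- The set of probability measures on the enlarged space under which `B` is a Brownian motion for
the enlarged filtration, `B_{T ∧ ·}` is uniformly integrable, and `B_T` has law `μ`. -/
structure IsEmbedding (μ : Measure ℝ) (P : Measure EnlargedSpace) : Prop where
  isProbabilityMeasure : IsProbabilityMeasure P
  brownian : IsFilteredBrownianMotion enlargedFiltration (fun t w => w.1 t) P
  uniformIntegrable :
    UniformIntegrable (fun (t : ℝ≥0) (w : EnlargedSpace) => w.1 (min w.2 t)) 1 P
  hasLaw : HasLaw (fun w : EnlargedSpace => w.1 w.2) μ P

/-! ### Regular conditional probabilities -/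

/-- `(K x)` is a family of regular conditional probability measures of `P` with respect to the
sub-σ-field `m`. -/
structure IsRegularCondProb {X : Type*} (m : MeasurableSpace X) {m₀ : MeasurableSpace X}
    (P : Measure X) (K : X → Measure X) : Prop where
  isProbabilityMeasure : ∀ x, IsProbabilityMeasure (K x)
  measurable : ∀ A, MeasurableSet[m₀] A → Measurable[m] (fun x => K x A)
  condExp_eq : ∀ ζ : X → ℝ, Measurable[m₀] ζ → (∃ C : ℝ, ∀ x, |ζ x| ≤ C) →
    P[ζ | m] =ᵐ[P] fun x => ∫ y, ζ y ∂(K x)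

/-! ### The enlarged stop-go set

`P₀` is the Wiener measure, and `K ω` is the conditional law of `(B, T)` given `B = ω`. -/

/-- The shifted Wiener measure: the law of `ω ⊗_t B` under the Wiener measure `P₀`. -/
def shiftedWiener (P₀ : Measure PathSpace) (t : ℝ≥0) (ω : PathSpace) : Measure PathSpace :=
  P₀.map (fun ω' => ω.concat t ω')

/-- `Q¹_{(ω, θ)}[A] = ∫ K (ω ⊗_θ ω') A P₀(dω')`. -/
def Q1 (P₀ : Measure PathSpace) (K : PathSpace → Measure EnlargedSpace) (w : EnlargedSpace) :
    Measure EnlargedSpace :=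
  P₀.bind (fun ω' => K (w.1.concat w.2 ω'))

open Classical in
/-- `Q²_{(ω, θ)}`: the measure `Q¹_{(ω, θ)}` conditioned on `{T > θ}` if this event has positive
probability, and otherwise the product of the shifted Wiener measure and the Dirac mass at `θ`. -/
def Q2 (P₀ : Measure PathSpace) (K : PathSpace → Measure EnlargedSpace) (w : EnlargedSpace) :
    Measure EnlargedSpace :=
  if 0 < Q1 P₀ K w {w' | w.2 < w'.2} then
    ProbabilityTheory.cond (Q1 P₀ K w) {w' | w.2 < w'.2}
  else
    (shiftedWiener P₀ w.2 w.1).prod (Measure.dirac w.2)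

/-- The shifted probability `Q*_{(ω, θ)}`: the law of `(B_{θ + ·} - B_θ, T - θ)` under
`Q²_{(ω, θ)}`. As `Q²_{(ω, θ)}` is carried by the elements `(ω, θ) ⊗ w'`, this is
`A ↦ Q²_{(ω, θ)}[{(ω, θ) ⊗ w' | w' ∈ A}]`. -/
def Qstar (P₀ : Measure PathSpace) (K : PathSpace → Measure EnlargedSpace) (w : EnlargedSpace) :
    Measure EnlargedSpace :=
  (Q2 P₀ K w).map (fun w' => (w'.1.restart w.2, w'.2 - w.2))

/-- The expectation `E[f⁺] - E[f⁻]`, with values in `[-∞, ∞]`. In `EReal` one has `⊤ - ⊤ = ⊥`,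
which is the convention `∞ - ∞ = -∞`. -/
def expect {X : Type*} {m : MeasurableSpace X} (P : Measure X) (f : X → ℝ) : EReal :=
  ((∫⁻ x, ENNReal.ofReal (f x) ∂P : ℝ≥0∞) : EReal) -
    ((∫⁻ x, ENNReal.ofReal (-f x) ∂P : ℝ≥0∞) : EReal)

/-- The enlarged stop-go set `SG*`. -/
def SGstar (ξ : EnlargedSpace → ℝ) (P₀ : Measure PathSpace)
    (K : PathSpace → Measure EnlargedSpace) : Set (EnlargedSpace × EnlargedSpace) :=
  {p | p.1.1 p.1.2 = p.2.1 p.2.2 ∧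
    (ξ p.1 : EReal) + expect (Qstar P₀ K p.1) (fun w => ξ (concatBar p.2 w)) >
      expect (Qstar P₀ K p.1) (fun w => ξ (concatBar p.1 w)) + (ξ p.2 : EReal)}

/-- The family equal to `Q²_{(ω, τ)}` on `{τ < T}` and, on `{τ = T}`, to the product of the Wiener
measure shifted at `(τ, ω)` and the Dirac mass at `θ`. -/
def Phat (P₀ : Measure PathSpace) (K : PathSpace → Measure EnlargedSpace)
    (τ : EnlargedSpace → ℝ≥0) (w : EnlargedSpace) : Measure EnlargedSpace :=
  if τ w < w.2 then Q2 P₀ K (w.1, τ w)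
  else (shiftedWiener P₀ (τ w) w.1).prod (Measure.dirac w.2)

end SkorokhodEmbedding

end

/-! For (i), every quantity entering `SGstar` depends on `(ω, θ)` only through the stopped pair
`(ω_{θ ∧ ·}, θ)`: concatenation forgets `ω` after `θ`, and `ξ` is non-anticipative. The stopping map
is measurable from `sigmaT`, so joint measurability of the kernels `Q1`, `Q2`, `Qstar` suffices.

For (ii), events of the enlarged filtration at time `t` do not see the value of `T` beyond `t`.
Hence, where `τ < T`, the time `τ` and the events of its past depend on the path alone
(`stoppingTime_eq_of_lt`, `mem_section_iff`); this yields `τ₀`. For the conditional law there are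
two regimes. On `{τ = T}` only the future of the path is unknown, and the strong Markov property at
`T` makes it a fresh Wiener path (`measure_inter_sigmaT`). On `{τ < T}`, disintegrate `P` along the
path by `K`; averaging `K` over the fresh continuation after `τ` gives `Q1`, and conditioning on the
additional information `T > τ` gives `Q2` by Bayes' rule (`lintegral_section_eq`,
`measure_section_eq`). -/

namespace SkorokhodEmbedding

/-! ### Path operations, measurability and uniqueness of measures on the path space -/

namespace PathSpace

@[ext]
protected lemma ext {ω ω' : PathSpace} (h : ∀ t, ω t = ω' t) : ω = ω' :=
  Subtype.ext (ContinuousMap.ext h)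

lemma measurable_iff {X : Type*} {m : MeasurableSpace X} {f : X → PathSpace} :
    Measurable f ↔ ∀ t, Measurable fun x => f x t := by
  refine ⟨fun h t => (measurable_apply t).comp h, fun h => ?_⟩
  rw [measurable_iff_comap_le, instMeasurableSpace, MeasurableSpace.comap_iSup]
  refine iSup_le fun t => ?_
  rw [MeasurableSpace.comap_comp]
  exact (h t).comap_le

lemma measurable_eval : Measurable fun p : PathSpace × ℝ≥0 => p.1 p.2 :=
  (measurable_uncurry_of_continuous_of_measurable (u := fun (t : ℝ≥0) (ω : PathSpace) => ω t)
    (fun ω => ω.continuous) measurable_apply).comp measurable_swap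

lemma concat_apply (ω : PathSpace) (θ : ℝ≥0) (ω' : PathSpace) (t : ℝ≥0) :
    ω.concat θ ω' t = ω (min t θ) + ω' (t - θ) := by
  show (if t < θ then ω t else ω θ + ω' (t - θ)) = _
  split_ifs with ht
  · rw [min_eq_left ht.le, tsub_eq_zero_of_le ht.le, ω'.apply_zero, add_zero]
  · rw [min_eq_right (not_lt.1 ht)]

lemma stopAt_apply (ω : PathSpace) (θ t : ℝ≥0) : ω.stopAt θ t = ω (min θ t) := rfl

lemma restart_apply (ω : PathSpace) (θ t : ℝ≥0) : ω.restart θ t = ω (θ + t) - ω θ := rfl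

lemma stopAt_concat (ω : PathSpace) (θ : ℝ≥0) (ω' : PathSpace) :
    (ω.stopAt θ).concat θ ω' = ω.concat θ ω' := by
  ext t
  simp [concat_apply, stopAt_apply]

lemma concat_restart (ω : PathSpace) (θ : ℝ≥0) : ω.concat θ (ω.restart θ) = ω := by
  ext t
  rw [concat_apply, restart_apply]
  rcases le_total t θ with h | h
  · rw [min_eq_left h, tsub_eq_zero_of_le h]
    simp
  · rw [min_eq_right h, add_tsub_cancel_of_le h]
    ring

lemma measurable_concat :
    Measurable fun p : (PathSpace × ℝ≥0) × PathSpace => p.1.1.concat p.1.2 p.2 := by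
  refine measurable_iff.2 fun t => ?_
  simp only [concat_apply]
  refine (measurable_eval.comp (g := fun p : PathSpace × ℝ≥0 => p.1 p.2)
    (f := fun p : (PathSpace × ℝ≥0) × PathSpace => (p.1.1, min t p.1.2)) (by fun_prop)).add
    (measurable_eval.comp (g := fun p : PathSpace × ℝ≥0 => p.1 p.2)
    (f := fun p : (PathSpace × ℝ≥0) × PathSpace => (p.2, t - p.1.2)) (by fun_prop))

lemma measurable_restart :
    Measurable fun p : PathSpace × ℝ≥0 => p.1.restart p.2 := by
  refine measurable_iff.2 fun t => ?_
  simp only [restart_apply]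
  exact (measurable_eval.comp (g := fun p : PathSpace × ℝ≥0 => p.1 p.2)
    (f := fun p : PathSpace × ℝ≥0 => (p.1, p.2 + t)) (by fun_prop)).sub measurable_eval

lemma continuous_restart_apply (ω : PathSpace) (t : ℝ≥0) :
    Continuous fun θ => ω.restart θ t :=
  (ω.continuous.comp (continuous_id.add continuous_const)).sub ω.continuous

/-- A finite measure on the path space is determined by its finite-dimensional laws. -/
lemma measure_ext {P Q : Measure PathSpace} [IsFiniteMeasure P]
    (h : ∀ I : Finset ℝ≥0, P.map (fun ω => I.restrict (fun t => ω t)) =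
      Q.map (fun ω => I.restrict (fun t => ω t))) : P = Q := by
  have hm : Measurable (fun ω : PathSpace => fun t => ω t) :=
    measurable_pi_iff.2 measurable_apply
  have hmap : P.map (fun ω t => ω t) = Q.map (fun ω t => ω t) := by
    have hP := isProjectiveLimit_map (P := P) (X := fun t (ω : PathSpace) => ω t) hm.aemeasurable
    have hQ := isProjectiveLimit_map (P := Q) (X := fun t (ω : PathSpace) => ω t) hm.aemeasurable
    simp_rw [h] at hP
    have := fun I : Finset ℝ≥0 => (by rw [← h I]; infer_instance :
      IsFiniteMeasure (Q.map (fun ω => I.restrict (fun t => ω t))))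
    exact hP.unique hQ
  ext A hA
  -- The continuous paths do not form a measurable subset of the product, but each measurable set of
  -- paths is the preimage of a product-measurable set, which is enough to transfer equality.
  have hcomap : (inferInstance : MeasurableSpace PathSpace) =
      MeasurableSpace.comap (fun (ω : PathSpace) t => ω t) inferInstance := by
    refine le_antisymm ?_ hm.comap_le
    refine iSup_le fun t => ?_
    have : (fun ω : PathSpace => ω t) = (fun f : ℝ≥0 → ℝ => f t) ∘ fun (ω : PathSpace) t => ω t :=
      rfl
    rw [this, ← MeasurableSpace.comap_comp]
    exact MeasurableSpace.comap_mono (measurable_pi_apply t).comap_le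
  obtain ⟨S, hS, rfl⟩ : MeasurableSet[MeasurableSpace.comap
      (fun (ω : PathSpace) t => ω t) inferInstance] A := by rwa [← hcomap]
  rw [← Measure.map_apply hm hS, ← Measure.map_apply hm hS, hmap]

end PathSpace

/-! ### The Markov properties of a Brownian motion with respect to a filtration -/

section BrownianMotion

variable {X : Type*} {m : MeasurableSpace X} {𝔽 : Filtration ℝ≥0 m} {P : Measure X}

/-- The latest increment is independent of `𝔽 (t a)`, and all earlier increments are measurable for
it; hence induction on the maximal index. -/
lemma IsFilteredBrownianMotion.hasIndepIncrements [IsProbabilityMeasure P] {W : ℝ≥0 → X → ℝ}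
    (hW : IsFilteredBrownianMotion 𝔽 W P) : HasIndepIncrements W P := by
  rw [hasIndepIncrements_iff_nat]
  intro t ht
  rw [iIndepFun_iff_measure_inter_preimage_eq_mul]
  intro S
  induction S using Finset.induction_on_max with
  | empty => simp
  | insert a S ha ih =>
    intro sets hsets
    have hS := ih (fun i hi => hsets i (Finset.mem_insert_of_mem hi))
    have haS : a ∉ S := fun h => lt_irrefl _ (ha a h)
    rw [Finset.set_biInter_insert, Finset.prod_insert haS, ← hS]
    refine (Indep_iff _ _ P).1 (hW.indep_increment (t a) (t (a + 1)) (ht (Nat.le_succ a))) _ _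
      ⟨sets a, hsets a (Finset.mem_insert_self _ _), rfl⟩ ?_
    refine Finset.measurableSet_biInter (m := 𝔽 (t a)) S fun i hi => ?_
    have hm : ∀ j ≤ a, Measurable[𝔽 (t a)] (W (t j)) := fun j hj =>
      (hW.adapted _).mono (𝔽.mono (ht hj)) le_rfl
    exact ((hm _ (ha i hi)).sub (hm _ (ha i hi).le)) (hsets i (Finset.mem_insert_of_mem hi))

lemma IsFilteredBrownianMotion.isPreBrownianReal [IsProbabilityMeasure P] {W : ℝ≥0 → X → ℝ}
    (hW : IsFilteredBrownianMotion 𝔽 W P) : IsPreBrownianReal W P := by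
  refine HasIndepIncrements.isPreBrownianReal_of_hasLaw (fun t => ?_) hW.hasIndepIncrements
  have h := hW.law_increment 0 t zero_le
  rw [tsub_zero] at h
  refine h.congr ?_
  filter_upwards [hW.zero] with x hx
  rw [hx, sub_zero]

variable {P₀ : Measure PathSpace} {W : X → PathSpace}

lemma IsFilteredBrownianMotion.map_eq [IsProbabilityMeasure P] (hP₀ : IsWienerMeasure P₀)
    (hWm : Measurable W) (hW : IsFilteredBrownianMotion 𝔽 (fun t x => W x t) P) :
    P.map W = P₀ := by
  have : IsProbabilityMeasure (P.map W) := Measure.isProbabilityMeasure_map hWm.aemeasurable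
  refine PathSpace.measure_ext fun I => ?_
  have hI : Measurable (fun ω : PathSpace => I.restrict (fun t => ω t)) :=
    measurable_pi_iff.2 fun t => PathSpace.measurable_apply t
  rw [Measure.map_map hI hWm, (hP₀.hasLaw I).map_eq, ← (hW.isPreBrownianReal.hasLaw I).map_eq]
  rfl

/-- The filtration `t ↦ 𝔽 (s + t)`. -/
def shiftFiltration (𝔽 : Filtration ℝ≥0 m) (s : ℝ≥0) : Filtration ℝ≥0 m where
  seq t := 𝔽 (s + t)
  mono' _ _ h := 𝔽.mono (add_le_add_right h s)
  le' _ := 𝔽.le _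

/-- Increments after `s` are independent of `A`, so conditioning on `A` changes neither their laws
nor their independence of the past. Uniqueness of the Wiener law then gives the Markov property
without computing joint laws. -/
lemma IsFilteredBrownianMotion.cond_restart [IsProbabilityMeasure P]
    (hW : IsFilteredBrownianMotion 𝔽 (fun t x => W x t) P)
    (s : ℝ≥0) {A : Set X} (hA : MeasurableSet[𝔽 s] A) (hPA : P A ≠ 0) :
    IsFilteredBrownianMotion (shiftFiltration 𝔽 s) (fun t x => (W x).restart s t) (P[|A]) := by
  have hA' := 𝔽.le s _ hA
  have hprob : IsProbabilityMeasure (P[|A]) := cond_isProbabilityMeasure hPA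
  have hincr : ∀ a b x, (W x).restart s b - (W x).restart s a = W x (s + b) - W x (s + a) := by
    intro a b x
    simp only [PathSpace.restart_apply]
    ring
  have hmeas : ∀ t, Measurable fun x => W x t := fun t => (hW.adapted t).mono (𝔽.le t) le_rfl
  have hind : ∀ a b : ℝ≥0, a ≤ b → ∀ D, MeasurableSet[𝔽 (s + a)] D → ∀ E, MeasurableSet E →
      P[|A] ((fun x => W x (s + b) - W x (s + a)) ⁻¹' E ∩ D) =
        P ((fun x => W x (s + b) - W x (s + a)) ⁻¹' E) * P[|A] D := by
    intro a b hab D hD E hE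
    rw [cond_apply hA', cond_apply hA', mul_left_comm, Set.inter_left_comm]
    congr 1
    exact (Indep_iff _ _ P).1 (hW.indep_increment (s + a) (s + b) (add_le_add_right hab s)) _ _
      ⟨E, hE, rfl⟩ ((𝔽.mono (le_self_add : s ≤ s + a) _ hA).inter hD)
  have hlaw : ∀ a b : ℝ≥0, a ≤ b → ∀ E, MeasurableSet E →
      P[|A] ((fun x => W x (s + b) - W x (s + a)) ⁻¹' E) =
        P ((fun x => W x (s + b) - W x (s + a)) ⁻¹' E) := by
    intro a b hab E hE
    have h := hind a b hab Set.univ MeasurableSet.univ E hE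
    rwa [Set.inter_univ, measure_univ, mul_one] at h
  refine ⟨fun t => ?_, ?_, ?_, fun a b hab => ?_, fun a b hab => ?_⟩
  · exact (hW.adapted (s + t)).sub ((hW.adapted s).mono (𝔽.mono le_self_add) le_rfl)
  · exact Filter.Eventually.of_forall fun x => ((W x).restart s).apply_zero
  · exact Filter.Eventually.of_forall fun x => ((W x).restart s).continuous
  · simp only [hincr]
    have hm : Measurable fun x => W x (s + b) - W x (s + a) := (hmeas _).sub (hmeas _)
    refine ⟨hm.aemeasurable, ?_⟩
    have h := (hW.law_increment (s + a) (s + b) (add_le_add_right hab s)).map_eq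
    rw [add_tsub_add_eq_tsub_left] at h
    rw [← h]
    ext E hE
    rw [Measure.map_apply hm hE, Measure.map_apply hm hE, hlaw a b hab E hE]
  · simp only [hincr]
    rw [Indep_iff]
    rintro _ D ⟨E, hE, rfl⟩ hD
    rw [hind a b hab D hD E hE, hlaw a b hab E hE]

/-- The simple Markov property. -/
lemma IsFilteredBrownianMotion.measure_inter_restart [IsProbabilityMeasure P]
    (hP₀ : IsWienerMeasure P₀) (hWm : Measurable W)
    (hW : IsFilteredBrownianMotion 𝔽 (fun t x => W x t) P)
    (s : ℝ≥0) {A : Set X} (hA : MeasurableSet[𝔽 s] A) :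
    (P.restrict A).map (fun x => (W x).restart s) = P A • P₀ := by
  have hR : Measurable fun x => (W x).restart s :=
    PathSpace.measurable_restart.comp (hWm.prodMk measurable_const)
  rcases eq_or_ne (P A) 0 with h0 | h0
  · rw [h0, zero_smul, Measure.restrict_eq_zero.2 h0, Measure.map_zero]
  have hprob : IsProbabilityMeasure (P[|A]) := cond_isProbabilityMeasure h0
  have h := (hW.cond_restart s hA h0).map_eq hP₀ hR
  rw [← h, ProbabilityTheory.cond, Measure.map_smul, smul_smul,
    ENNReal.mul_inv_cancel h0 (measure_ne_top _ _), one_smul]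

/-- The dyadic approximation from above `(⌊2ⁿ t⌋ + 1) / 2ⁿ` of the time `t`. -/
noncomputable def dyadicAbove (n : ℕ) (t : ℝ≥0) : ℝ≥0 := (⌊2 ^ n * t⌋₊ + 1 : ℝ≥0) / 2 ^ n

lemma measurable_dyadicAbove (n : ℕ) : Measurable (dyadicAbove n) := by
  unfold dyadicAbove
  fun_prop

lemma tendsto_dyadicAbove (t : ℝ≥0) :
    Filter.Tendsto (fun n => dyadicAbove n t) Filter.atTop (nhds t) := by
  have h2 : ∀ n : ℕ, (0 : ℝ≥0) < 2 ^ n := fun n => by positivity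
  have hlim : Filter.Tendsto (fun n : ℕ => t + (1 / 2 : ℝ≥0) ^ n) Filter.atTop (nhds t) := by
    have := (tendsto_pow_atTop_nhds_zero_of_lt_one (r := (1 / 2 : ℝ≥0)) zero_le
      (by rw [div_lt_one (by norm_num)]; norm_num)).const_add t
    rwa [add_zero] at this
  refine tendsto_of_tendsto_of_tendsto_of_le_of_le tendsto_const_nhds hlim (fun n => ?_)
    fun n => ?_
  · show t ≤ dyadicAbove n t
    rw [dyadicAbove, le_div_iff₀ (h2 n), mul_comm]
    exact (Nat.lt_floor_add_one _).le
  · show dyadicAbove n t ≤ t + (1 / 2) ^ n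
    rw [dyadicAbove, div_le_iff₀ (h2 n), add_mul, ← mul_pow]
    have : (1 / 2 : ℝ≥0) * 2 = 1 := by norm_num
    rw [this, one_pow, mul_comm t]
    exact add_le_add_left (Nat.floor_le zero_le) 1

/-- On this event `dyadicAbove n (τ x)` is the constant `(k + 1) / 2 ^ n`, a time by which the event
is already decided; the simple Markov property applies there. -/
lemma measurableSet_inter_floor_eq {τ : X → ℝ≥0}
    (hτ : IsStoppingTime 𝔽 (fun x => (τ x : WithTop ℝ≥0)))
    {A : Set X} (hA : MeasurableSet[hτ.measurableSpace] A) (n k : ℕ) :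
    MeasurableSet[𝔽 ((k + 1 : ℝ≥0) / 2 ^ n)] (A ∩ {x | ⌊2 ^ n * τ x⌋₊ = k}) := by
  have h2 : (0 : ℝ≥0) < 2 ^ n := by positivity
  have hle : (k : ℝ≥0) / 2 ^ n ≤ (k + 1) / 2 ^ n := by
    gcongr
    exact le_self_add
  -- The redundant bound `τ ≤ (k + 1) / 2 ^ n` is what membership of `A` in the past of `τ` calls
  -- for.
  have hset : A ∩ {x | ⌊2 ^ n * τ x⌋₊ = k} =
      (A ∩ {x | (τ x : WithTop ℝ≥0) ≤ ((k + 1 : ℝ≥0) / 2 ^ n : ℝ≥0)}) ∩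
        ({x | (τ x : WithTop ℝ≥0) < ((k + 1 : ℝ≥0) / 2 ^ n : ℝ≥0)} \
          {x | (τ x : WithTop ℝ≥0) < ((k : ℝ≥0) / 2 ^ n : ℝ≥0)}) := by
    ext x
    simp only [Set.mem_inter_iff, Set.mem_ofPred_eq, Set.mem_sdiff, WithTop.coe_le_coe,
      WithTop.coe_lt_coe, not_lt, Nat.floor_eq_iff (zero_le : (0 : ℝ≥0) ≤ 2 ^ n * τ x)]
    rw [lt_div_iff₀' h2, div_le_iff₀' h2, le_div_iff₀' h2]
    constructor
    · rintro ⟨h, h1, h3⟩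
      exact ⟨⟨h, h3.le⟩, h3, h1⟩
    · rintro ⟨⟨h, -⟩, h3, h1⟩
      exact ⟨h, h1, h3⟩
  rw [hset]
  exact (((hτ.measurableSet A).1 hA).2 _).inter
    ((hτ.measurableSet_lt _).diff (hτ.measurableSet_lt_le hle))

lemma IsFilteredBrownianMotion.map_restart_dyadicAbove [IsProbabilityMeasure P]
    (hP₀ : IsWienerMeasure P₀) (hWm : Measurable W)
    (hW : IsFilteredBrownianMotion 𝔽 (fun t x => W x t) P)
    {τ : X → ℝ≥0} (hτ : IsStoppingTime 𝔽 (fun x => (τ x : WithTop ℝ≥0)))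
    {A : Set X} (hA : MeasurableSet[hτ.measurableSpace] A) (n : ℕ) :
    (P.restrict A).map (fun x => (W x).restart (dyadicAbove n (τ x))) = P A • P₀ := by
  have hm : Measurable τ := hτ.measurable'.untopA
  have hR : Measurable fun x => (W x).restart (dyadicAbove n (τ x)) := 
    PathSpace.measurable_restart.comp (hWm.prodMk
      ((measurable_dyadicAbove n).comp hm))
  set B : ℕ → Set X := fun k => A ∩ {x | ⌊2 ^ n * τ x⌋₊ = k} with hB
  have hBm : ∀ k : ℕ, MeasurableSet[𝔽 ((k + 1 : ℝ≥0) / 2 ^ n)] (B k) :=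
    measurableSet_inter_floor_eq hτ hA n
  have hBm' : ∀ k, MeasurableSet (B k) := fun k => 𝔽.le _ _ (hBm k)
  have hdisj : Pairwise (Function.onFun Disjoint B) := by
    intro i j hij
    refine Set.disjoint_left.2 fun x hx hx' => hij ?_
    exact hx.2.symm.trans hx'.2
  have hAB : A = ⋃ k, B k := by
    rw [hB, ← Set.inter_iUnion]
    refine (Set.inter_eq_left.2 fun x _ => ?_).symm
    exact Set.mem_iUnion.2 ⟨⌊2 ^ n * τ x⌋₊, rfl⟩
  have hk : ∀ k, (P.restrict (B k)).map (fun x => (W x).restart (dyadicAbove n (τ x))) =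
      P (B k) • P₀ := by
    intro k
    rw [← hW.measure_inter_restart hP₀ hWm _ (hBm k)]
    refine Measure.map_congr ?_
    filter_upwards [ae_restrict_mem (hBm' k)] with x hx
    rw [dyadicAbove, show ⌊2 ^ n * τ x⌋₊ = k from hx.2]
  ext C hC
  rw [Measure.map_apply hR hC, hAB, Measure.restrict_iUnion hdisj hBm',
    Measure.sum_apply _ (hR hC), Measure.smul_apply, measure_iUnion hdisj hBm', smul_eq_mul,
    ← ENNReal.tsum_mul_right]
  refine tsum_congr fun k => ?_
  rw [← Measure.map_apply hR hC, hk k, Measure.smul_apply, smul_eq_mul]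

/-- The strong Markov property. -/
lemma IsFilteredBrownianMotion.map_restart_stoppingTime [IsProbabilityMeasure P]
    (hP₀ : IsWienerMeasure P₀) (hWm : Measurable W)
    (hW : IsFilteredBrownianMotion 𝔽 (fun t x => W x t) P)
    {τ : X → ℝ≥0} (hτ : IsStoppingTime 𝔽 (fun x => (τ x : WithTop ℝ≥0)))
    {A : Set X} (hA : MeasurableSet[hτ.measurableSpace] A) :
    (P.restrict A).map (fun x => (W x).restart (τ x)) = P A • P₀ := by
  have hm : Measurable τ := hτ.measurable'.untopA
  have hR : Measurable fun x => (W x).restart (τ x) :=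
    PathSpace.measurable_restart.comp (hWm.prodMk hm)
  have hRn : ∀ n, Measurable fun x => (W x).restart (dyadicAbove n (τ x)) := by
    intro n
    exact PathSpace.measurable_restart.comp (hWm.prodMk
      ((measurable_dyadicAbove n).comp hm))
  have hP₀' : IsProbabilityMeasure P₀ := (hP₀.hasLaw ∅).isProbabilityMeasure
  have hfin : IsFiniteMeasure (P A • P₀) := Measure.smul_finite P₀ (measure_ne_top P A)
  refine PathSpace.measure_ext fun I => ?_
  have hI : Measurable (fun ω : PathSpace => I.restrict (fun t => ω t)) :=
    measurable_pi_iff.2 fun t => PathSpace.measurable_apply t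
  refine ext_of_forall_integral_eq_of_IsFiniteMeasure fun f => ?_
  have hf : Measurable f := f.continuous.measurable
  have hfI : Measurable (fun ω : PathSpace => f (I.restrict fun t => ω t)) := hf.comp hI
  have hmap : ∀ Q : Measure PathSpace, ∫ y, f y ∂(Q.map fun ω => I.restrict fun t => ω t) =
      ∫ ω : PathSpace, f (I.restrict fun t => ω t) ∂Q := fun Q =>
    integral_map hI.aemeasurable hf.aestronglyMeasurable
  rw [hmap, hmap, integral_map hR.aemeasurable hfI.aestronglyMeasurable]
  have hn : ∀ n, ∫ x in A, f (I.restrict fun t => (W x).restart (dyadicAbove n (τ x)) t) ∂P =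
      ∫ ω : PathSpace, f (I.restrict fun t => ω t) ∂(P A • P₀) := by
    intro n
    rw [← hW.map_restart_dyadicAbove hP₀ hWm hτ hA n,
      integral_map (hRn n).aemeasurable hfI.aestronglyMeasurable]
  -- The integrals along the dyadic approximations are constant in `n`; path continuity and
  -- boundedness of `f` identify their limit with the integral at `τ`.
  refine tendsto_nhds_unique (f := fun n : ℕ => ∫ x in A,
    f (I.restrict fun t => (W x).restart (dyadicAbove n (τ x)) t) ∂P) (l := Filter.atTop) ?_ ?_
  · refine tendsto_integral_of_dominated_convergence (fun _ => ‖f‖)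
      (fun n => (hfI.comp (hRn n)).aestronglyMeasurable) (integrable_const _)
      (fun n => Filter.Eventually.of_forall fun x => f.norm_coe_le_norm _)
      (Filter.Eventually.of_forall fun x => ?_)
    refine (f.continuous.tendsto _).comp (tendsto_pi_nhds.2 fun t => ?_)
    exact ((W x).continuous_restart_apply t).continuousAt.tendsto.comp (tendsto_dyadicAbove (τ x))
  · simp only [hn]
    exact tendsto_const_nhds

/-- The strong Markov property: given the past of `τ`, the path restarted at `τ` has law `P₀`. -/
lemma IsFilteredBrownianMotion.lintegral_restart_stoppingTime [IsProbabilityMeasure P]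
    (hP₀ : IsWienerMeasure P₀) (hWm : Measurable W)
    (hW : IsFilteredBrownianMotion 𝔽 (fun t x => W x t) P)
    {τ : X → ℝ≥0} (hτ : IsStoppingTime 𝔽 (fun x => (τ x : WithTop ℝ≥0)))
    {A : Set X} (hA : MeasurableSet[hτ.measurableSpace] A)
    {Y : Type*} [MeasurableSpace Y] {Φ : X → Y} (hΦ : Measurable[hτ.measurableSpace] Φ)
    {H : Y × PathSpace → ℝ≥0∞} (hH : Measurable H) :
    ∫⁻ x in A, H (Φ x, (W x).restart (τ x)) ∂P =
      ∫⁻ x in A, ∫⁻ ω', H (Φ x, ω') ∂P₀ ∂P := by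
  have hm : Measurable τ := hτ.measurable'.untopA
  have hR : Measurable fun x => (W x).restart (τ x) :=
    PathSpace.measurable_restart.comp (hWm.prodMk hm)
  have hΦ' : Measurable Φ := hΦ.mono hτ.measurableSpace_le le_rfl
  have hP₀' : IsProbabilityMeasure P₀ := (hP₀.hasLaw ∅).isProbabilityMeasure
  -- Applying the set version to `{Φ ∈ D} ∩ A`, again an event of the past, gives the product
  -- formula on rectangles.
  have hprod : ((P.restrict A).map Φ).prod P₀ =
      (P.restrict A).map (fun x => (Φ x, (W x).restart (τ x))) := by
    refine Measure.prod_eq fun D C hD hC => ?_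
    have h := congrArg (fun ν => ν C) (hW.map_restart_stoppingTime hP₀ hWm hτ
      ((hΦ hD).inter hA))
    simp only [Measure.smul_apply, smul_eq_mul] at h
    rw [Measure.map_apply hR hC, Measure.restrict_apply (hR hC)] at h
    rw [Measure.map_apply (hΦ'.prodMk hR) (hD.prod hC), Measure.map_apply hΦ' hD,
      Measure.restrict_apply (hΦ' hD), ← h,
      Measure.restrict_apply ((hΦ'.prodMk hR) (hD.prod hC))]
    congr 1
    ext x
    simp only [Set.mem_inter_iff, Set.mem_preimage, Set.mem_prod]
    tauto
  calc _ = ∫⁻ p, H p ∂((P.restrict A).map (fun x => (Φ x, (W x).restart (τ x)))) :=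
        (lintegral_map hH (hΦ'.prodMk hR)).symm
    _ = ∫⁻ y, ∫⁻ ω', H (y, ω') ∂P₀ ∂((P.restrict A).map Φ) := by
        rw [← hprod, lintegral_prod _ hH.aemeasurable]
    _ = _ := lintegral_map hH.lintegral_prod_right' hΦ'

end BrownianMotion

/-! ### Stopping on the enlarged space and the kernels `Q¹`, `Q²`, `Q*` -/

lemma measurable_apply_enlargedFiltration {s t : ℝ≥0} (hst : s ≤ t) :
    Measurable[enlargedFiltration t] fun w : EnlargedSpace => w.1 s :=
  Measurable.of_comap_le <| (le_iSup₂_of_le (f := fun (u : ℝ≥0) (_ : u ≤ t) =>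
    MeasurableSpace.comap (fun w : EnlargedSpace => w.1 u) inferInstance) s hst le_rfl).trans
    le_sup_left

/-- The past `(ω_{τ ∧ ·}, τ)` of a stopping time `τ` is measurable with respect to the
σ-field of the events prior to `τ`. -/
lemma measurable_stopAt_stoppingTime {τ : EnlargedSpace → ℝ≥0}
    (hτ : IsStoppingTime enlargedFiltration (fun w => (τ w : WithTop ℝ≥0))) :
    Measurable[hτ.measurableSpace] fun w : EnlargedSpace => (w.1.stopAt (τ w), τ w) := by
  refine Measurable.prodMk (PathSpace.measurable_iff.2 fun u => ?_) hτ.measurable.untopA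
  -- The value at `u` of the path stopped at `τ` is this adapted continuous, hence progressive,
  -- process evaluated at `τ`.
  have hadapt : StronglyAdapted enlargedFiltration
      fun (t : ℝ≥0) (w : EnlargedSpace) => w.1 (min t u) := fun t =>
    (measurable_apply_enlargedFiltration (min_le_left t u)).stronglyMeasurable
  exact measurable_stoppedValue (hadapt.isStronglyProgressive_of_continuous
    fun w => w.1.continuous.comp (continuous_id.min continuous_const)) hτ

lemma measurable_stopAt_sigmaT :
    Measurable[sigmaT] fun w : EnlargedSpace => (w.1.stopAt w.2, w.2) :=
  measurable_stopAt_stoppingTime isStoppingTime_T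

/-! ### Measurability of the kernels and of the stop-go set -/

section Kernels

variable {P₀ : Measure PathSpace} {K : PathSpace → Measure EnlargedSpace}

lemma Q1_apply (hK : Measurable K) (w : EnlargedSpace) {A : Set EnlargedSpace}
    (hA : MeasurableSet A) : Q1 P₀ K w A = ∫⁻ ω', K (w.1.concat w.2 ω') A ∂P₀ :=
  Measure.bind_apply hA (hK.comp
    (PathSpace.measurable_concat.comp (measurable_const.prodMk measurable_id))).aemeasurable

lemma Q1_stopAt (ω : PathSpace) (θ : ℝ≥0) : Q1 P₀ K (ω.stopAt θ, θ) = Q1 P₀ K (ω, θ) := by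
  simp only [Q1, PathSpace.stopAt_concat]

lemma shiftedWiener_stopAt (ω : PathSpace) (θ : ℝ≥0) :
    shiftedWiener P₀ θ (ω.stopAt θ) = shiftedWiener P₀ θ ω := by
  simp only [shiftedWiener, PathSpace.stopAt_concat]

lemma Q2_stopAt (ω : PathSpace) (θ : ℝ≥0) : Q2 P₀ K (ω.stopAt θ, θ) = Q2 P₀ K (ω, θ) := by
  simp only [Q2, Q1_stopAt, shiftedWiener_stopAt]

lemma Qstar_stopAt (ω : PathSpace) (θ : ℝ≥0) :
    Qstar P₀ K (ω.stopAt θ, θ) = Qstar P₀ K (ω, θ) := by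
  simp only [Qstar, Q2_stopAt]

/-- The branches of `Q²`. -/
lemma Q2_eq (w : EnlargedSpace) (p : Prop) [Decidable p]
    (hp : p ↔ 0 < Q1 P₀ K w {w' | w.2 < w'.2}) : Q2 P₀ K w =
      if p then ProbabilityTheory.cond (Q1 P₀ K w) {w' | w.2 < w'.2}
      else (shiftedWiener P₀ w.2 w.1).prod (Measure.dirac w.2) := by
  by_cases h : p
  · rw [Q2, if_pos h, if_pos (hp.1 h)]
  · rw [Q2, if_neg h, if_neg (fun h' => h (hp.2 h'))]

variable [IsProbabilityMeasure P₀]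

lemma measurable_Q1 (hK : Measurable K) : Measurable (Q1 P₀ K) := by
  refine Measure.measurable_of_measurable_coe _ fun A hA => ?_
  simp only [Q1_apply hK _ hA]
  exact Measurable.lintegral_prod_right'
    (f := fun p : EnlargedSpace × PathSpace => K (p.1.1.concat p.1.2 p.2) A)
    ((Measure.measurable_coe hA).comp (hK.comp PathSpace.measurable_concat))

lemma isProbabilityMeasure_Q1 (hK : Measurable K) (hKp : ∀ ω, IsProbabilityMeasure (K ω))
    (w : EnlargedSpace) : IsProbabilityMeasure (Q1 P₀ K w) :=
  ⟨by rw [Q1_apply hK _ MeasurableSet.univ]; simp⟩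

lemma shiftedWiener_prod_dirac_apply (ω : PathSpace) (θ : ℝ≥0) {A : Set EnlargedSpace}
    (hA : MeasurableSet A) :
    (shiftedWiener P₀ θ ω).prod (Measure.dirac θ) A =
      P₀ ((fun ω' => (ω.concat θ ω', θ)) ⁻¹' A) := by
  have hc : Measurable fun ω' => ω.concat θ ω' :=
    PathSpace.measurable_concat.comp
      (measurable_prodMk_left (x := ((ω, θ) : EnlargedSpace)))
  rw [shiftedWiener, Measure.prod_dirac, Measure.map_map (by fun_prop) hc,
    Measure.map_apply (by fun_prop) hA]
  rfl

lemma isProbabilityMeasure_shiftedWiener_prod_dirac (ω : PathSpace) (t θ : ℝ≥0) :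
    IsProbabilityMeasure ((shiftedWiener P₀ t ω).prod (Measure.dirac θ)) := by
  have hc : Measurable fun ω' => ω.concat t ω' :=
    PathSpace.measurable_concat.comp
      (measurable_prodMk_left (x := ((ω, t) : EnlargedSpace)))
  have : IsProbabilityMeasure (shiftedWiener P₀ t ω) :=
    Measure.isProbabilityMeasure_map hc.aemeasurable
  infer_instance

lemma measurable_shiftedWiener_prod_dirac :
    Measurable fun w : EnlargedSpace => (shiftedWiener P₀ w.2 w.1).prod (Measure.dirac w.2) := by
  refine Measure.measurable_of_measurable_coe _ fun A hA => ?_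
  simp only [shiftedWiener_prod_dirac_apply _ _ hA]
  exact measurable_measure_prodMk_left (ν := P₀)
    (s := (fun p : EnlargedSpace × PathSpace => (p.1.1.concat p.1.2 p.2, p.1.2)) ⁻¹' A)
    ((PathSpace.measurable_concat.prodMk (measurable_snd.comp measurable_fst)) hA)

lemma measurableSet_lt_snd (θ : ℝ≥0) : MeasurableSet {w' : EnlargedSpace | θ < w'.2} :=
  measurableSet_lt measurable_const measurable_snd

lemma isProbabilityMeasure_Q2 (hK : Measurable K) (hKp : ∀ ω, IsProbabilityMeasure (K ω))
    (w : EnlargedSpace) : IsProbabilityMeasure (Q2 P₀ K w) := by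
  have := isProbabilityMeasure_Q1 (P₀ := P₀) hK hKp w
  rw [Q2]
  split_ifs with h
  · exact cond_isProbabilityMeasure h.ne'
  · exact isProbabilityMeasure_shiftedWiener_prod_dirac _ _ _

/-- Needed because the event `{T > θ}` moves with the parameter of the kernel. -/
lemma measurable_kernel_section {α β : Type*} [MeasurableSpace α] [MeasurableSpace β]
    {κ : α → Measure β} (hκ : Measurable κ) (hp : ∀ a, IsProbabilityMeasure (κ a))
    (S : α → Set β) (hS : MeasurableSet {p : α × β | p.2 ∈ S p.1}) :
    Measurable fun a => κ a (S a) := by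
  let k : Kernel α β := ⟨κ, hκ⟩
  have : IsMarkovKernel k := ⟨hp⟩
  exact Kernel.measurable_kernel_prodMk_left (κ := k) hS

lemma measurable_cond_Q1 (hK : Measurable K) (hKp : ∀ ω, IsProbabilityMeasure (K ω)) :
    Measurable fun w : EnlargedSpace =>
      ProbabilityTheory.cond (Q1 P₀ K w) {w' | w.2 < w'.2} := by
  have hS : MeasurableSet {p : EnlargedSpace × EnlargedSpace | p.1.2 < p.2.2} :=
    measurableSet_lt (by fun_prop) (by fun_prop)
  have hp := isProbabilityMeasure_Q1 (P₀ := P₀) hK hKp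
  have h1 : Measurable fun w : EnlargedSpace => Q1 P₀ K w {w' | w.2 < w'.2} :=
    measurable_kernel_section (measurable_Q1 hK) hp (fun w => {w' | w.2 < w'.2}) hS
  refine Measure.measurable_of_measurable_coe _ fun A hA => ?_
  have happ : ∀ w : EnlargedSpace, ProbabilityTheory.cond (Q1 P₀ K w) {w' | w.2 < w'.2} A =
      (Q1 P₀ K w {w' | w.2 < w'.2})⁻¹ * Q1 P₀ K w ({w' | w.2 < w'.2} ∩ A) := fun w =>
    cond_apply (measurableSet_lt_snd w.2) _ _
  simp only [happ]
  exact h1.inv.mul (measurable_kernel_section (measurable_Q1 hK) hp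
    (fun w => {w' | w.2 < w'.2} ∩ A) (hS.inter (measurable_snd hA)))

lemma measurable_Q2 (hK : Measurable K) (hKp : ∀ ω, IsProbabilityMeasure (K ω)) :
    Measurable (Q2 P₀ K) := by
  have hS : MeasurableSet {p : EnlargedSpace × EnlargedSpace | p.1.2 < p.2.2} :=
    measurableSet_lt (by fun_prop) (by fun_prop)
  have h1 : Measurable fun w : EnlargedSpace => Q1 P₀ K w {w' | w.2 < w'.2} :=
    measurable_kernel_section (measurable_Q1 hK) (isProbabilityMeasure_Q1 (P₀ := P₀) hK hKp)
      (fun w => {w' | w.2 < w'.2}) hS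
  classical
  have hpos : MeasurableSet {w : EnlargedSpace | 0 < Q1 P₀ K w {w' | w.2 < w'.2}} :=
    measurableSet_lt measurable_const h1
  rw [funext fun w => Q2_eq (P₀ := P₀) (K := K) w
    (w ∈ {w : EnlargedSpace | 0 < Q1 P₀ K w {w' | w.2 < w'.2}}) Iff.rfl]
  exact Measurable.ite hpos (measurable_cond_Q1 hK hKp) measurable_shiftedWiener_prod_dirac

lemma isProbabilityMeasure_Qstar (hK : Measurable K) (hKp : ∀ ω, IsProbabilityMeasure (K ω))
    (w : EnlargedSpace) : IsProbabilityMeasure (Qstar P₀ K w) := by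
  have := isProbabilityMeasure_Q2 (P₀ := P₀) hK hKp w
  exact Measure.isProbabilityMeasure_map ((PathSpace.measurable_restart.comp
    (measurable_fst.prodMk measurable_const)).prodMk (by fun_prop)).aemeasurable

lemma measurable_Qstar (hK : Measurable K) (hKp : ∀ ω, IsProbabilityMeasure (K ω)) :
    Measurable (Qstar P₀ K) := by
  refine Measure.measurable_of_measurable_coe _ fun A hA => ?_
  have hm : Measurable fun p : EnlargedSpace × EnlargedSpace =>
      (p.2.1.restart p.1.2, p.2.2 - p.1.2) :=
    (PathSpace.measurable_restart.comp (by fun_prop :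
      Measurable fun p : EnlargedSpace × EnlargedSpace => (p.2.1, p.1.2))).prodMk (by fun_prop)
  have happ : ∀ w, Qstar P₀ K w A = Q2 P₀ K w
      ((fun w' => (w'.1.restart w.2, w'.2 - w.2)) ⁻¹' A) := fun w =>
    Measure.map_apply (hm.comp measurable_prodMk_left) hA
  simp only [happ]
  exact measurable_kernel_section (measurable_Q2 hK hKp) (isProbabilityMeasure_Q2 hK hKp)
    (fun w => (fun w' => (w'.1.restart w.2, w'.2 - w.2)) ⁻¹' A) (hm hA)

lemma measurable_expect {α β : Type*} [MeasurableSpace α] [MeasurableSpace β]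
    {κ : α → Measure β} (hκ : Measurable κ) (hp : ∀ a, IsProbabilityMeasure (κ a))
    {f : α × β → ℝ} (hf : Measurable f) :
    Measurable fun a => expect (κ a) fun b => f (a, b) := by
  let k : Kernel α β := ⟨κ, hκ⟩
  have : IsMarkovKernel k := ⟨hp⟩
  have h : ∀ g : α × β → ℝ, Measurable g →
      Measurable fun a => ((∫⁻ b, ENNReal.ofReal (g (a, b)) ∂(κ a) : ℝ≥0∞) : EReal) := fun g hg =>
    (Measurable.lintegral_kernel_prod_right' (κ := k) hg.ennreal_ofReal).coe_ereal_ennreal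
  exact (h f hf).add (h _ hf.neg).neg

lemma measurable_concatBar :
    Measurable fun p : EnlargedSpace × EnlargedSpace => concatBar p.1 p.2 :=
  (PathSpace.measurable_concat.comp (by fun_prop : Measurable
    fun p : EnlargedSpace × EnlargedSpace => ((p.1.1, p.1.2), p.2.1))).prodMk (by fun_prop)

lemma concatBar_stopAt (ω : PathSpace) (θ : ℝ≥0) (w' : EnlargedSpace) :
    concatBar (ω.stopAt θ, θ) w' = concatBar (ω, θ) w' := by
  simp only [concatBar, PathSpace.stopAt_concat]

lemma measurableSet_SGstar {ξ : EnlargedSpace → ℝ} (hξ : Measurable ξ)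
    (hK : Measurable K) (hKp : ∀ ω, IsProbabilityMeasure (K ω)) :
    MeasurableSet (SGstar ξ P₀ K) := by
  have hQ : Measurable fun p : EnlargedSpace × EnlargedSpace => Qstar P₀ K p.1 :=
    (measurable_Qstar hK hKp).comp measurable_fst
  have hQp : ∀ p : EnlargedSpace × EnlargedSpace, IsProbabilityMeasure (Qstar P₀ K p.1) :=
    fun p => isProbabilityMeasure_Qstar hK hKp p.1
  have hE : ∀ g : EnlargedSpace × EnlargedSpace → EnlargedSpace, Measurable g →
      Measurable fun p : EnlargedSpace × EnlargedSpace =>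
        expect (Qstar P₀ K p.1) fun w => ξ (concatBar (g p) w) := fun g hg =>
    measurable_expect hQ hQp (f := fun q => ξ (concatBar (g q.1) q.2))
      (hξ.comp (measurable_concatBar.comp ((hg.comp measurable_fst).prodMk measurable_snd)))
  have hl := (hE _ measurable_fst).add (hξ.comp measurable_snd).coe_real_ereal
  have hr := (hξ.comp measurable_fst).coe_real_ereal.add (hE _ measurable_snd)
  exact (measurableSet_eq_fun (PathSpace.measurable_eval.comp measurable_fst)
    (PathSpace.measurable_eval.comp measurable_snd)).inter (measurableSet_lt hl hr)

/-- The set is its own preimage under stopping both components, and that map is measurable from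
`sigmaT.prod sigmaT`. -/
lemma measurableSet_SGstar_sigmaT {ξ : EnlargedSpace → ℝ} (hξ : Measurable ξ)
    (hna : NonAnticipative ξ) (hK : Measurable K) (hKp : ∀ ω, IsProbabilityMeasure (K ω)) :
    MeasurableSet[sigmaT.prod sigmaT] (SGstar ξ P₀ K) := by
  have hpre : SGstar ξ P₀ K = (fun p : EnlargedSpace × EnlargedSpace =>
      ((p.1.1.stopAt p.1.2, p.1.2), (p.2.1.stopAt p.2.2, p.2.2))) ⁻¹' SGstar ξ P₀ K := by
    ext ⟨⟨ω, θ⟩, ⟨ω', θ'⟩⟩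
    simp only [SGstar, Set.mem_preimage, Set.mem_ofPred_eq, Qstar_stopAt, concatBar_stopAt,
      ← hna ω θ, ← hna ω' θ', PathSpace.stopAt_apply, min_self]
  rw [hpre]
  refine Measurable.prodMk (m := sigmaT.prod sigmaT) ?_ ?_ (measurableSet_SGstar hξ hK hKp)
  · exact measurable_stopAt_sigmaT.comp (@measurable_fst _ _ sigmaT sigmaT)
  · exact measurable_stopAt_sigmaT.comp (@measurable_snd _ _ sigmaT sigmaT)

end Kernels

/-! ### Stopping times of the enlarged filtration -/

/-- Up to time `t`, the events of the enlarged filtration do not distinguish between the values of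
`T` greater than `t`. -/
lemma mem_iff_of_enlargedFiltration {t : ℝ≥0} {A : Set EnlargedSpace}
    (hA : MeasurableSet[enlargedFiltration t] A) (ω : PathSpace) {θ θ' : ℝ≥0}
    (hθ : t < θ) (hθ' : t < θ') : (ω, θ) ∈ A ↔ (ω, θ') ∈ A := by
  -- Collapsing all values of `T` above `t` to the single value `t + 1` fixes each generator of the
  -- σ-field, hence each of its events.
  set f : EnlargedSpace → EnlargedSpace := fun w => (w.1, if w.2 ≤ t then w.2 else t + 1) with hf
  have hle : enlargedFiltration t ≤ MeasurableSpace.invariants f := by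
    refine sup_le (iSup₂_le fun u _ => ?_) (MeasurableSpace.generateFrom_le ?_)
    · rintro _ ⟨S, hS, rfl⟩
      exact ⟨((PathSpace.measurable_apply u).comp measurable_fst) hS, rfl⟩
    · rintro _ ⟨u, hu, rfl⟩
      refine ⟨measurableSet_le measurable_snd measurable_const, ?_⟩
      ext w
      simp only [hf, Set.mem_preimage, Set.mem_ofPred_eq]
      split_ifs with h
      · rfl
      · have h' := not_le.1 h
        exact iff_of_false (not_le.2 (hu.trans_lt (lt_add_one t))) (not_le.2 (hu.trans_lt h'))
  have hinv : f ⁻¹' A = A := (hle A hA).2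
  have h : ∀ η, t < η → ((ω, η) ∈ A ↔ (ω, t + 1) ∈ A) := fun η hη => by
    conv_lhs => rw [← hinv]
    simp only [hf, Set.mem_preimage, if_neg (not_le.2 hη)]
  rw [h θ hθ, h θ' hθ']

lemma measurable_fst_enlargedFiltration (t : ℝ≥0) :
    Measurable[enlargedFiltration t, PathSpace.filtration t]
      (Prod.fst : EnlargedSpace → PathSpace) := by
  rw [measurable_iff_le_map]
  refine iSup₂_le fun u hu => ?_
  rintro _ ⟨S, hS, rfl⟩
  exact measurable_apply_enlargedFiltration hu hS

/-- With `T` frozen at `c > t`, the generators `{T ≤ u}`, `u ≤ t`, become empty and only path events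
remain. -/
lemma measurable_prodMk_const_enlargedFiltration {t c : ℝ≥0} (h : t < c) :
    Measurable[PathSpace.filtration t, enlargedFiltration t] fun ω : PathSpace => (ω, c) := by
  rw [measurable_iff_le_map]
  refine sup_le (iSup₂_le fun u hu => ?_) (MeasurableSpace.generateFrom_le ?_)
  · rintro _ ⟨S, hS, rfl⟩
    have : MeasurableSpace.comap (fun ω : PathSpace => ω u) inferInstance ≤
        PathSpace.filtration t := le_iSup₂_of_le (f := fun (u : ℝ≥0) (_ : u ≤ t) =>
      MeasurableSpace.comap (fun ω : PathSpace => ω u) inferInstance) u hu le_rfl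
    exact this _ ⟨S, hS, rfl⟩
  · rintro _ ⟨u, hu, rfl⟩
    have : (fun ω : PathSpace => (ω, c)) ⁻¹' {w : EnlargedSpace | w.2 ≤ u} = ∅ := by
      ext ω
      simp only [Set.mem_preimage, Set.mem_ofPred_eq, Set.mem_empty_iff_false, iff_false, not_le]
      exact hu.trans_lt h
    show MeasurableSet[PathSpace.filtration t] _
    rw [this]
    exact @MeasurableSet.empty _ (PathSpace.filtration t)

lemma measurable_section_enlargedFiltration {t c : ℝ≥0} (h : t < c) :
    Measurable[enlargedFiltration t, enlargedFiltration t] fun w : EnlargedSpace => (w.1, c) :=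
  (measurable_prodMk_const_enlargedFiltration h).comp (measurable_fst_enlargedFiltration t)

lemma measurableSet_stoppingTime_of_forall {X : Type*} {m : MeasurableSpace X}
    {𝔽 : Filtration ℝ≥0 m} {τ : X → ℝ≥0} (hτ : IsStoppingTime 𝔽 (fun x => (τ x : WithTop ℝ≥0)))
    {A : Set X} (hA : ∀ t, MeasurableSet[𝔽 t] (A ∩ {x | (τ x : WithTop ℝ≥0) ≤ t})) :
    MeasurableSet[hτ.measurableSpace] A := by
  refine (hτ.measurableSet A).2 ⟨?_, hA⟩
  have hU : A = ⋃ n : ℕ, A ∩ {x | (τ x : WithTop ℝ≥0) ≤ (n : ℝ≥0)} := by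
    rw [← Set.inter_iUnion]
    refine (Set.inter_eq_left.2 fun x _ => ?_).symm
    obtain ⟨n, hn⟩ := exists_nat_ge (τ x)
    exact Set.mem_iUnion.2 ⟨n, WithTop.coe_le_coe.2 hn⟩
  rw [hU]
  exact MeasurableSet.iUnion fun n => le_iSup (fun t => (𝔽 t : MeasurableSpace X)) _ _ (hA n)

section StoppingTimeBeforeT

variable {τ : EnlargedSpace → ℝ≥0}

/-- The events `{τ ≤ s}` cannot tell `θ` from `θ'` when both exceed `s`; comparing in both
directions gives equality. -/
lemma stoppingTime_eq_of_lt
    (hτ : IsStoppingTime enlargedFiltration (fun w => (τ w : WithTop ℝ≥0)))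
    {ω : PathSpace} {θ θ' : ℝ≥0} (h : τ (ω, θ) < θ) (h' : τ (ω, θ) < θ') :
    τ (ω, θ') = τ (ω, θ) := by
  have key : ∀ {s η η' : ℝ≥0}, s < η → s < η' → τ (ω, η) ≤ s → τ (ω, η') ≤ s := by
    intro s η η' hη hη' hs
    exact WithTop.coe_le_coe.1
      ((mem_iff_of_enlargedFiltration (hτ s) ω hη hη').1 (WithTop.coe_le_coe.2 hs))
  have h1 := key h h' le_rfl
  exact le_antisymm h1 (key (h1.trans_lt h') (h1.trans_lt h) le_rfl)

/-- A stopping time `τ ≤ T` of the enlarged filtration is of the form `τ₀ ∧ T` for a stopping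
time `τ₀` of the canonical filtration. -/
lemma exists_stoppingTime_eq_min
    (hτ : IsStoppingTime enlargedFiltration (fun w => (τ w : WithTop ℝ≥0)))
    (hle : ∀ w, τ w ≤ w.2) :
    ∃ τ₀ : PathSpace → WithTop ℝ≥0, IsStoppingTime PathSpace.filtration τ₀ ∧
      ∀ w, (τ w : WithTop ℝ≥0) = min (τ₀ w.1) (w.2 : WithTop ℝ≥0) := by
  classical
  -- By `stoppingTime_eq_of_lt`, `τ (ω, θ)` is the same for all `θ` with `τ (ω, θ) < θ`. If no such
  -- `θ` exists, `τ` always waits for `T`, whence `⊤`.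
  let τ₀ : PathSpace → WithTop ℝ≥0 := fun ω =>
    if h : ∃ θ, τ (ω, θ) < θ then ((τ (ω, h.choose) : ℝ≥0) : WithTop ℝ≥0) else ⊤
  have hmin : ∀ w : EnlargedSpace, (τ w : WithTop ℝ≥0) = min (τ₀ w.1) (w.2 : WithTop ℝ≥0) := by
    rintro ⟨ω, θ⟩
    by_cases h : ∃ θ, τ (ω, θ) < θ
    · have hs := h.choose_spec
      simp only [τ₀, dif_pos h]
      rw [← WithTop.coe_min, WithTop.coe_inj]
      rcases lt_or_ge (τ (ω, h.choose)) θ with h1 | h1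
      · rw [min_eq_left h1.le, stoppingTime_eq_of_lt hτ hs h1]
      · rw [min_eq_right h1]
        refine (hle (ω, θ)).antisymm (not_lt.1 fun h2 => ?_)
        have h2' : τ (ω, θ) < θ := h2
        have h3 := stoppingTime_eq_of_lt hτ h2' (h2'.trans (h1.trans_lt hs))
        exact absurd (h3 ▸ h1) (not_le.2 h2')
    · simp only [τ₀, dif_neg h, min_eq_right le_top]
      exact WithTop.coe_inj.2 ((hle (ω, θ)).antisymm (not_lt.1 fun h1 => h ⟨θ, h1⟩))
  refine ⟨τ₀, fun t => ?_, hmin⟩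
  -- Freezing `T` at `t + 1`, beyond `t`, makes the minimum with `T` irrelevant at level `t`.
  have hset : {ω | τ₀ ω ≤ t} =
      (fun ω : PathSpace => (ω, t + 1)) ⁻¹' {w | (τ w : WithTop ℝ≥0) ≤ t} := by
    ext ω
    simp only [Set.mem_preimage, Set.mem_ofPred_eq, hmin, min_le_iff]
    refine ⟨Or.inl, fun h => h.resolve_right ?_⟩
    exact not_le.2 (WithTop.coe_lt_coe.2 (lt_add_one t))
  rw [hset]
  exact measurable_prodMk_const_enlargedFiltration (lt_add_one t) (hτ t)

/-- This replaces `τ` by a stopping time depending on the path alone. For `t ≥ c` the condition is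
automatic since `τ (ω, c) ≤ c`. -/
lemma isStoppingTime_section
    (hτ : IsStoppingTime enlargedFiltration (fun w => (τ w : WithTop ℝ≥0)))
    (hle : ∀ w, τ w ≤ w.2) (c : ℝ≥0) :
    IsStoppingTime enlargedFiltration (fun w => (τ (w.1, c) : WithTop ℝ≥0)) := by
  intro t
  rcases lt_or_ge t c with h | h
  · exact measurable_section_enlargedFiltration h (hτ t)
  · have : {w : EnlargedSpace | (τ (w.1, c) : WithTop ℝ≥0) ≤ t} = Set.univ :=
      Set.eq_univ_of_forall fun w => WithTop.coe_le_coe.2 ((hle (w.1, c)).trans h)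
    rw [this]
    exact @MeasurableSet.univ _ (enlargedFiltration t)

/-- The cut-off `τ ≤ n < c` keeps every time involved below the frozen value `c`, where sections are
measurable. -/
lemma measurableSet_section
    (hτ : IsStoppingTime enlargedFiltration (fun w => (τ w : WithTop ℝ≥0)))
    (hle : ∀ w, τ w ≤ w.2) {A : Set EnlargedSpace} (hA : MeasurableSet[hτ.measurableSpace] A)
    {n c : ℝ≥0} (hc : n < c) :
    MeasurableSet[(isStoppingTime_section hτ hle c).measurableSpace]
      {w : EnlargedSpace | (w.1, c) ∈ A ∧ τ (w.1, c) ≤ n} := by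
  refine measurableSet_stoppingTime_of_forall _ fun t => ?_
  have hset : {w : EnlargedSpace | (w.1, c) ∈ A ∧ τ (w.1, c) ≤ n} ∩
      {w | (τ (w.1, c) : WithTop ℝ≥0) ≤ t} = (fun w : EnlargedSpace => (w.1, c)) ⁻¹'
        (A ∩ {w | (τ w : WithTop ℝ≥0) ≤ (min t n : ℝ≥0)}) := by
    ext w
    simp only [Set.mem_inter_iff, Set.mem_ofPred_eq, Set.mem_preimage, WithTop.coe_le_coe,
      le_min_iff]
    tauto
  rw [hset]
  exact enlargedFiltration.mono (min_le_left t n) _ (measurable_section_enlargedFiltration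
    ((min_le_right t n).trans_lt hc) (((hτ.measurableSet A).1 hA).2 _))

/-- On `{τ < T, τ ≤ n}`, both `τ` and the events of its past may be read off at `T = c`; the
dependence on `T` survives only in the constraint that `T` exceed the section. -/
lemma mem_section_iff
    (hτ : IsStoppingTime enlargedFiltration (fun w => (τ w : WithTop ℝ≥0)))
    {A : Set EnlargedSpace} (hA : MeasurableSet[hτ.measurableSpace] A)
    {n c : ℝ≥0} (hc : n < c) (w : EnlargedSpace) :
    (w ∈ A ∧ τ w < w.2 ∧ τ w ≤ n) ↔
      ((w.1, c) ∈ A ∧ τ (w.1, c) ≤ n) ∧ τ (w.1, c) < w.2 := by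
  obtain ⟨ω, θ⟩ := w
  have key : ∀ {η η' : ℝ≥0}, (ω, η) ∈ A → τ (ω, η) < η → τ (ω, η) < η' → (ω, η') ∈ A := by
    intro η η' h h1 h2
    exact ((mem_iff_of_enlargedFiltration (((hτ.measurableSet A).1 hA).2 (τ (ω, η))) ω h1 h2).1
      ⟨h, le_refl ((τ (ω, η) : ℝ≥0) : WithTop ℝ≥0)⟩).1
  constructor
  · rintro ⟨h, h1, h2⟩
    have h3 := stoppingTime_eq_of_lt hτ h1 (h2.trans_lt hc)
    refine ⟨⟨key h h1 (h2.trans_lt hc), ?_⟩, ?_⟩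
    · show τ (ω, c) ≤ n
      rwa [h3]
    · show τ (ω, c) < θ
      rwa [h3]
  · rintro ⟨⟨h, h2⟩, h1⟩
    have h3 := stoppingTime_eq_of_lt hτ (h2.trans_lt hc) h1
    exact ⟨key h (h2.trans_lt hc) h1, by rwa [h3], by rwa [h3]⟩

end StoppingTimeBeforeT

/-! ### Regular conditional probabilities -/

section RegularCondProb

variable {X : Type*} {m m₀ : MeasurableSpace X} {P : Measure X} {κ : X → Measure X}

lemma measurable_measure_of_forall (hκ : ∀ A, MeasurableSet[m₀] A → Measurable[m] fun x => κ x A) :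
    Measurable[m] κ := by
  exact Measure.measurable_of_measurable_coe _ hκ

lemma IsRegularCondProb.bind_eq [IsProbabilityMeasure P] (hm : m ≤ m₀)
    (h : IsRegularCondProb m P κ) : P.bind κ = P := by
  have hκ : Measurable κ := (measurable_measure_of_forall h.measurable).mono hm le_rfl
  have := h.isProbabilityMeasure
  ext A hA
  rw [Measure.bind_apply hA hκ.aemeasurable]
  have hA1 : ∀ x, ∫ y, A.indicator (fun _ => (1 : ℝ)) y ∂(κ x) = (κ x A).toReal := fun x => by
    rw [integral_indicator hA, setIntegral_const, smul_eq_mul, mul_one]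
    rfl
  have hce := h.condExp_eq (A.indicator fun _ => (1 : ℝ)) (measurable_const.indicator hA)
    ⟨1, fun x => by by_cases hx : x ∈ A <;> simp [hx]⟩
  have hint := integral_condExp (μ := P) (f := A.indicator fun _ => (1 : ℝ)) hm
  rw [integral_congr_ae hce] at hint
  simp only [hA1] at hint
  have hκA : Measurable fun x => κ x A := (Measure.measurable_coe hA).comp hκ
  rw [integral_toReal hκA.aemeasurable
    (Filter.Eventually.of_forall fun x => measure_lt_top _ _), integral_indicator hA,
    setIntegral_const, smul_eq_mul, mul_one, measureReal_def] at hint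
  refine (ENNReal.toReal_eq_toReal_iff' ?_ (measure_ne_top _ _)).1 hint
  refine ne_top_of_le_ne_top ENNReal.one_ne_top ?_
  calc ∫⁻ x, κ x A ∂P ≤ ∫⁻ _, 1 ∂P := lintegral_mono fun x => prob_le_one
    _ = 1 := by simp

/-- The hypothesis says that `P.restrict A` is invariant under `κ`, and invariance of a measure
passes directly to integrals of bounded functions. -/
lemma IsRegularCondProb.of_measure_inter [IsProbabilityMeasure P] (hm : m ≤ m₀)
    (hp : ∀ x, IsProbabilityMeasure (κ x)) (hκ : Measurable[m] κ)
    (h : ∀ A, MeasurableSet[m] A → ∀ G, MeasurableSet[m₀] G → P (A ∩ G) = ∫⁻ x in A, κ x G ∂P) :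
    IsRegularCondProb m P κ := by
  refine ⟨hp, fun A hA => (Measure.measurable_coe hA).comp hκ, fun ζ hζ ⟨C, hC⟩ => ?_⟩
  have hint : ∀ (Q : Measure X) [IsFiniteMeasure Q], Integrable ζ Q := fun Q _ =>
    Integrable.of_bound hζ.aestronglyMeasurable C (Filter.Eventually.of_forall hC)
  have hgm : StronglyMeasurable[m] fun x => ∫ y, ζ y ∂(κ x) := by
    let k : @Kernel X X m m₀ := @Kernel.mk X X m m₀ κ hκ
    exact hζ.stronglyMeasurable.integral_kernel (κ := k)
  have hκ₀ : Measurable κ := hκ.mono hm le_rfl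
  have hbound : ∀ x, ‖∫ y, ζ y ∂(κ x)‖ ≤ C := fun x => by
    have := hp x
    simpa using norm_integral_le_of_norm_le_const (μ := κ x) (f := ζ) (Filter.Eventually.of_forall hC)
  have hgint : Integrable (fun x => ∫ y, ζ y ∂(κ x)) P :=
    Integrable.of_bound (hgm.mono hm).aestronglyMeasurable C (Filter.Eventually.of_forall hbound)
  refine (ae_eq_condExp_of_forall_setIntegral_eq hm (hint P) (fun s _ _ => hgint.integrableOn)
    (fun A hA _ => ?_) hgm.aestronglyMeasurable).symm
  have hbind : (P.restrict A).bind κ = P.restrict A := by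
    ext G hG
    rw [Measure.bind_apply hG hκ₀.aemeasurable, Measure.restrict_apply hG, Set.inter_comm,
      h A hA G hG]
  let k : Kernel X X := ⟨κ, hκ₀⟩
  have hk : (k ∘ₖ Kernel.const Unit (P.restrict A)) () = P.restrict A := by
    rw [Kernel.comp_apply, Kernel.const_apply]
    exact hbind
  have hI := Kernel.integral_comp (κ := Kernel.const Unit (P.restrict A)) (η := k) (a := ())
    (f := ζ) (by rw [hk]; exact hint _)
  rw [hk, Kernel.const_apply] at hI
  exact hI.symm

end RegularCondProb

/-- Continuous paths are determined by a countable dense set of times. This makes `{B = ω}` an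
event, so `K ω` is carried by it almost surely. -/
instance : MeasurableSingletonClass PathSpace := by
  refine ⟨fun ω => ?_⟩
  have hset : ({ω} : Set PathSpace) =
      ⋂ n : ℕ, {ω' | ω' (TopologicalSpace.denseSeq ℝ≥0 n) = ω (TopologicalSpace.denseSeq ℝ≥0 n)} := by
    ext ω'
    simp only [Set.mem_singleton_iff, Set.mem_iInter, Set.mem_ofPred_eq]
    refine ⟨fun h n => h ▸ rfl, fun h => PathSpace.ext fun t => ?_⟩
    have hd := (TopologicalSpace.denseRange_denseSeq ℝ≥0)
    exact congrFun (ω'.continuous.ext_on hd ω.continuous (by rintro _ ⟨n, rfl⟩; exact h n)) t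
  rw [hset]
  exact MeasurableSet.iInter fun n =>
    measurableSet_eq_fun (PathSpace.measurable_apply _) measurable_const

/-! ### Conditional laws on `{ρ < T}` and at `T` -/

section Disintegration

variable {P₀ : Measure PathSpace} {K : PathSpace → Measure EnlargedSpace}
  {P : Measure EnlargedSpace}

lemma sigmaB_le : sigmaB ≤ (inferInstance : MeasurableSpace EnlargedSpace) :=
  iSup_le fun t => ((PathSpace.measurable_apply t).comp measurable_fst).comap_le

lemma measurable_of_isRegularCondProb (hK : IsRegularCondProb sigmaB P fun w => K w.1) :
    Measurable K := by
  refine Measure.measurable_of_measurable_coe _ fun A hA => ?_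
  exact ((hK.measurable A hA).mono sigmaB_le le_rfl).comp
    (measurable_prodMk_right (y := (0 : ℝ≥0)))

lemma lintegral_eq_lintegral_lintegral [IsProbabilityMeasure P]
    (hK : IsRegularCondProb sigmaB P fun w => K w.1) {F : EnlargedSpace → ℝ≥0∞}
    (hF : Measurable F) : ∫⁻ w, F w ∂P = ∫⁻ w, ∫⁻ w', F w' ∂(K w.1) ∂P := by
  conv_lhs => rw [← hK.bind_eq sigmaB_le]
  exact Measure.lintegral_bind ((measurable_of_isRegularCondProb hK).comp
    measurable_fst).aemeasurable hF.aemeasurable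

lemma ae_fst_eq (hKp : ∀ ω, IsProbabilityMeasure (K ω)) (hK_supp : ∀ ω, K ω {w | w.1 = ω} = 1)
    (ω : PathSpace) : ∀ᵐ w' ∂(K ω), w'.1 = ω := by
  have := hKp ω
  exact (mem_ae_iff_prob_eq_one (measurable_fst (measurableSet_singleton ω))).2 (hK_supp ω)

variable [IsProbabilityMeasure P]

/-- The conditional law of `(B, T)` on `{ρ < T}` given the past of a stopping time `ρ` that is a
function of the path alone. -/
lemma lintegral_section_eq (hP₀ : IsWienerMeasure P₀)
    (hB : IsFilteredBrownianMotion enlargedFiltration (fun t w => w.1 t) P)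
    (hK : IsRegularCondProb sigmaB P fun w => K w.1) (hK_supp : ∀ ω, K ω {w | w.1 = ω} = 1)
    {ρ : PathSpace → ℝ≥0}
    (hρ : IsStoppingTime enlargedFiltration (fun w => (ρ w.1 : WithTop ℝ≥0)))
    {A : Set PathSpace} (hA : MeasurableSet[hρ.measurableSpace] (Prod.fst ⁻¹' A))
    {g : EnlargedSpace → ℝ≥0∞} (hg : Measurable g) {G : Set EnlargedSpace}
    (hG : MeasurableSet G) :
    ∫⁻ w in Prod.fst ⁻¹' A ∩ ({w | ρ w.1 < w.2} ∩ G), g (w.1.stopAt (ρ w.1), ρ w.1) ∂P =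
      ∫⁻ w in Prod.fst ⁻¹' A, g (w.1.stopAt (ρ w.1), ρ w.1) *
        Q1 P₀ K (w.1, ρ w.1) ({w' | ρ w.1 < w'.2} ∩ G) ∂P := by
  have hKm := measurable_of_isRegularCondProb hK
  have hKp : ∀ ω, IsProbabilityMeasure (K ω) := fun ω => hK.isProbabilityMeasure (ω, 0)
  have hP₀' : IsProbabilityMeasure P₀ := (hP₀.hasLaw ∅).isProbabilityMeasure
  have hρm : Measurable fun w : EnlargedSpace => ρ w.1 := hρ.measurable'.untopA
  have hAm : MeasurableSet (Prod.fst ⁻¹' A : Set EnlargedSpace) := hρ.measurableSpace_le _ hA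
  have hΦ := measurable_stopAt_stoppingTime hρ
  have hΦ' : Measurable fun w : EnlargedSpace => (w.1.stopAt (ρ w.1), ρ w.1) :=
    hΦ.mono hρ.measurableSpace_le le_rfl
  have hSm : MeasurableSet ({w : EnlargedSpace | ρ w.1 < w.2} ∩ G) :=
    (measurableSet_lt hρm measurable_snd).inter hG
  have hSK : Measurable fun p : EnlargedSpace × PathSpace =>
      g p.1 * K (p.1.1.concat p.1.2 p.2) ({w' | p.1.2 < w'.2} ∩ G) := by
    refine (hg.comp measurable_fst).mul (measurable_kernel_section
      (hKm.comp PathSpace.measurable_concat) (fun p => hKp _)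
      (fun p => {w' | p.1.2 < w'.2} ∩ G) ?_)
    exact (measurableSet_lt (by fun_prop :
      Measurable fun q : (EnlargedSpace × PathSpace) × EnlargedSpace => q.1.1.2)
      (by fun_prop)).inter (measurable_snd hG)
  have hSM := hB.lintegral_restart_stoppingTime hP₀ measurable_fst hρ hA hΦ hSK
  -- Gluing the restarted path onto the stopped one recovers the path, so the left side involves `K
  -- w.1` itself and the right side its average over fresh continuations.
  simp only [PathSpace.stopAt_concat, PathSpace.concat_restart] at hSM
  calc _ = ∫⁻ w, (Prod.fst ⁻¹' A ∩ ({w | ρ w.1 < w.2} ∩ G)).indicator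
          (fun w => g (w.1.stopAt (ρ w.1), ρ w.1)) w ∂P :=
        (lintegral_indicator (hAm.inter hSm) _).symm
    _ = ∫⁻ w, ∫⁻ w', (Prod.fst ⁻¹' A ∩ ({w | ρ w.1 < w.2} ∩ G)).indicator
          (fun w => g (w.1.stopAt (ρ w.1), ρ w.1)) w' ∂(K w.1) ∂P :=
        lintegral_eq_lintegral_lintegral hK ((hg.comp hΦ').indicator (hAm.inter hSm))
    _ = ∫⁻ w, (Prod.fst ⁻¹' A).indicator (fun w => g (w.1.stopAt (ρ w.1), ρ w.1) *
          K w.1 ({w' | ρ w.1 < w'.2} ∩ G)) w ∂P := by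
        refine lintegral_congr fun w => ?_
        -- Under `K w.1` the path is almost surely `w.1`, so every factor depending on the path
        -- alone is constant.
        have hae : ∀ᵐ w' ∂(K w.1), (Prod.fst ⁻¹' A ∩ ({w | ρ w.1 < w.2} ∩ G)).indicator
            (fun w => g (w.1.stopAt (ρ w.1), ρ w.1)) w' =
            ({w' | ρ w.1 < w'.2} ∩ G).indicator (fun _ =>
              (Prod.fst ⁻¹' A).indicator (fun w => g (w.1.stopAt (ρ w.1), ρ w.1)) w) w' := by
          filter_upwards [ae_fst_eq hKp hK_supp w.1] with w' hw'
          classical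
          simp only [Set.indicator_apply, Set.mem_inter_iff, Set.mem_preimage, Set.mem_ofPred_eq,
            hw']
          split_ifs <;> first | rfl | tauto
        rw [lintegral_congr_ae hae, lintegral_indicator_const
          ((measurableSet_lt_snd _).inter hG)]
        by_cases hw : w ∈ (Prod.fst ⁻¹' A : Set EnlargedSpace)
        · rw [Set.indicator_of_mem hw, Set.indicator_of_mem hw]
        · rw [Set.indicator_of_notMem hw, Set.indicator_of_notMem hw, zero_mul]
    _ = ∫⁻ w in Prod.fst ⁻¹' A, g (w.1.stopAt (ρ w.1), ρ w.1) *
          K w.1 ({w' | ρ w.1 < w'.2} ∩ G) ∂P := lintegral_indicator hAm _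
    _ = _ := hSM
    _ = _ := by
        refine lintegral_congr fun w => ?_
        rw [Q1_apply hKm _ ((measurableSet_lt_snd _).inter hG)]
        refine lintegral_const_mul _ ?_
        exact (Measure.measurable_coe ((measurableSet_lt_snd _).inter hG)).comp
          (hKm.comp (PathSpace.measurable_concat.comp
            (measurable_prodMk_left (x := ((w.1, ρ w.1) : EnlargedSpace)))))

/-- Bayes' rule. If `{T > θ}` is null both sides vanish, so the default branch of `Q2` plays no
role. -/
lemma Q1_mul_Q2 [IsProbabilityMeasure P₀] (hK : Measurable K)
    (hKp : ∀ ω, IsProbabilityMeasure (K ω)) (w : EnlargedSpace) (G : Set EnlargedSpace) :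
    Q2 P₀ K w G * Q1 P₀ K w {w' | w.2 < w'.2} = Q1 P₀ K w ({w' | w.2 < w'.2} ∩ G) := by
  have := isProbabilityMeasure_Q1 (P₀ := P₀) hK hKp w
  by_cases h : 0 < Q1 P₀ K w {w' | w.2 < w'.2}
  · rw [Q2, if_pos h, mul_comm, cond_apply (measurableSet_lt_snd _), ← mul_assoc,
      ENNReal.mul_inv_cancel h.ne' (measure_ne_top _ _), one_mul]
  · have h0 : Q1 P₀ K w {w' | w.2 < w'.2} = 0 := nonpos_iff_eq_zero.1 (not_lt.1 h)
    rw [h0, mul_zero, measure_mono_null Set.inter_subset_left h0]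

/-- Use `lintegral_section_eq` with weight `1` and event `G`, then with weight `Q2 · G` and the full
event; `Q1_mul_Q2` matches the two right-hand sides. -/
lemma measure_section_eq (hP₀ : IsWienerMeasure P₀)
    (hB : IsFilteredBrownianMotion enlargedFiltration (fun t w => w.1 t) P)
    (hK : IsRegularCondProb sigmaB P fun w => K w.1) (hK_supp : ∀ ω, K ω {w | w.1 = ω} = 1)
    {ρ : PathSpace → ℝ≥0}
    (hρ : IsStoppingTime enlargedFiltration (fun w => (ρ w.1 : WithTop ℝ≥0)))
    {A : Set PathSpace} (hA : MeasurableSet[hρ.measurableSpace] (Prod.fst ⁻¹' A))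
    {G : Set EnlargedSpace} (hG : MeasurableSet G) :
    P (Prod.fst ⁻¹' A ∩ {w | ρ w.1 < w.2} ∩ G) =
      ∫⁻ w in Prod.fst ⁻¹' A ∩ {w | ρ w.1 < w.2}, Q2 P₀ K (w.1, ρ w.1) G ∂P := by
  have hKm := measurable_of_isRegularCondProb hK
  have hKp : ∀ ω, IsProbabilityMeasure (K ω) := fun ω => hK.isProbabilityMeasure (ω, 0)
  have hP₀' : IsProbabilityMeasure P₀ := (hP₀.hasLaw ∅).isProbabilityMeasure
  have h1 := lintegral_section_eq hP₀ hB hK hK_supp hρ hA (g := fun _ => 1) measurable_const hG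
  have h2 := lintegral_section_eq hP₀ hB hK hK_supp hρ hA (g := fun w => Q2 P₀ K w G)
    ((Measure.measurable_coe hG).comp (measurable_Q2 hKm hKp)) MeasurableSet.univ
  simp only [Q2_stopAt, Set.inter_univ] at h2
  rw [h2, Set.inter_assoc]
  rw [setLIntegral_const, one_mul] at h1
  rw [h1]
  refine lintegral_congr fun w => ?_
  rw [one_mul]
  exact (Q1_mul_Q2 hKm hKp (w.1, ρ w.1) G).symm

/-- `T` is itself a stopping time: given its past, the path after `T` is a fresh Wiener path and `T`
is known. -/
lemma measure_inter_sigmaT (hP₀ : IsWienerMeasure P₀)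
    (hB : IsFilteredBrownianMotion enlargedFiltration (fun t w => w.1 t) P)
    {A : Set EnlargedSpace} (hA : MeasurableSet[sigmaT] A)
    {G : Set EnlargedSpace} (hG : MeasurableSet G) :
    P (A ∩ G) = ∫⁻ w in A, (shiftedWiener P₀ w.2 w.1).prod (Measure.dirac w.2) G ∂P := by
  have hP₀' : IsProbabilityMeasure P₀ := (hP₀.hasLaw ∅).isProbabilityMeasure
  have hm : Measurable fun p : EnlargedSpace × PathSpace => (p.1.1.concat p.1.2 p.2, p.1.2) :=
    PathSpace.measurable_concat.prodMk (by fun_prop)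
  have hSM := hB.lintegral_restart_stoppingTime hP₀ measurable_fst isStoppingTime_T hA
    measurable_stopAt_sigmaT ((measurable_one.indicator hG : Measurable
      (G.indicator (1 : EnlargedSpace → ℝ≥0∞))).comp hm)
  simp only [Function.comp_apply, PathSpace.stopAt_concat, PathSpace.concat_restart] at hSM
  rw [lintegral_indicator_one hG, Measure.restrict_apply hG, Set.inter_comm] at hSM
  rw [hSM]
  refine lintegral_congr fun w => ?_
  rw [shiftedWiener_prod_dirac_apply _ _ hG]
  exact lintegral_indicator_one ((hm.comp (measurable_prodMk_left (x := w))) hG)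

end Disintegration

/-! ### The conditional law given the past of `τ` -/

section Phat

variable {P₀ : Measure PathSpace} {K : PathSpace → Measure EnlargedSpace}
  {P : Measure EnlargedSpace} {τ : EnlargedSpace → ℝ≥0}

lemma isProbabilityMeasure_Phat [IsProbabilityMeasure P₀] (hK : Measurable K)
    (hKp : ∀ ω, IsProbabilityMeasure (K ω)) (w : EnlargedSpace) :
    IsProbabilityMeasure (Phat P₀ K τ w) := by
  rw [Phat]
  split_ifs
  · exact isProbabilityMeasure_Q2 hK hKp _
  · exact isProbabilityMeasure_shiftedWiener_prod_dirac _ _ _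

lemma measurable_Phat [IsProbabilityMeasure P₀] (hK : Measurable K)
    (hKp : ∀ ω, IsProbabilityMeasure (K ω))
    (hτ : IsStoppingTime enlargedFiltration (fun w => (τ w : WithTop ℝ≥0)))
    (hle : ∀ w, τ w ≤ w.2) : Measurable[hτ.measurableSpace] (Phat P₀ K τ) := by
  classical
  have hΦ := measurable_stopAt_stoppingTime hτ
  have hset : MeasurableSet[hτ.measurableSpace] {w : EnlargedSpace | τ w < w.2} := by
    have h := (IsStoppingTime.measurableSet_eq_stopping_time hτ isStoppingTime_T).compl
    convert h using 1
    ext w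
    simp only [Set.mem_ofPred_eq, Set.mem_compl_iff, WithTop.coe_inj]
    exact (hle w).lt_iff_ne
  -- Off `{τ < T}` one has `θ = τ`, so both branches are functions of the past `(ω_{τ ∧ ·}, τ)`.
  have heq : Phat P₀ K τ = fun w => if w ∈ {w : EnlargedSpace | τ w < w.2} then
      Q2 P₀ K (w.1.stopAt (τ w), τ w) else
      (shiftedWiener P₀ (τ w) (w.1.stopAt (τ w))).prod (Measure.dirac (τ w)) := by
    funext w
    simp only [Q2_stopAt, shiftedWiener_stopAt, Phat, Set.mem_ofPred_eq]
    split_ifs with h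
    · rfl
    · rw [(hle w).antisymm (not_lt.1 h)]
  rw [heq]
  exact Measurable.ite hset ((measurable_Q2 hK hKp).comp hΦ)
    (measurable_shiftedWiener_prod_dirac.comp hΦ)

/-- On `{τ < T, τ ≤ n}` the time `τ` agrees with its section at `c = n + 1`, to which
`measure_section_eq` applies; then `n → ∞`. -/
lemma measure_inter_lt_eq [IsProbabilityMeasure P] (hP₀ : IsWienerMeasure P₀)
    (hB : IsFilteredBrownianMotion enlargedFiltration (fun t w => w.1 t) P)
    (hK : IsRegularCondProb sigmaB P fun w => K w.1) (hK_supp : ∀ ω, K ω {w | w.1 = ω} = 1)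
    (hτ : IsStoppingTime enlargedFiltration (fun w => (τ w : WithTop ℝ≥0)))
    (hle : ∀ w, τ w ≤ w.2) {A : Set EnlargedSpace} (hA : MeasurableSet[hτ.measurableSpace] A)
    {G : Set EnlargedSpace} (hG : MeasurableSet G) :
    P ((A ∩ {w | τ w < w.2}) ∩ G) = ∫⁻ w in A ∩ {w | τ w < w.2}, Q2 P₀ K (w.1, τ w) G ∂P := by
  have hKm := measurable_of_isRegularCondProb hK
  have hKp : ∀ ω, IsProbabilityMeasure (K ω) := fun ω => hK.isProbabilityMeasure (ω, 0)
  have hP₀' : IsProbabilityMeasure P₀ := (hP₀.hasLaw ∅).isProbabilityMeasure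
  have hτm : Measurable τ := hτ.measurable'.untopA
  have hAm : MeasurableSet A := hτ.measurableSpace_le _ hA
  set S : ℕ → Set EnlargedSpace := fun n => {w | w ∈ A ∧ τ w < w.2 ∧ τ w ≤ (n : ℝ≥0)} with hS
  have hSm : ∀ n, MeasurableSet (S n) := fun n => hAm.inter
    ((measurableSet_lt hτm measurable_snd).inter
      (measurableSet_le (f := τ) (g := fun _ => (n : ℝ≥0)) hτm measurable_const))
  have hSmono : Monotone S := fun i j hij w hw =>
    ⟨hw.1, hw.2.1, hw.2.2.trans (Nat.cast_le.2 hij)⟩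
  have hSU : A ∩ {w | τ w < w.2} = ⋃ n, S n := by
    ext w
    simp only [hS, Set.mem_inter_iff, Set.mem_ofPred_eq, Set.mem_iUnion]
    refine ⟨fun h => ?_, fun ⟨n, h⟩ => ⟨h.1, h.2.1⟩⟩
    obtain ⟨n, hn⟩ := exists_nat_ge (τ w)
    exact ⟨n, h.1, h.2, hn⟩
  have hn : ∀ n : ℕ, P (S n ∩ G) = ∫⁻ w in S n, Q2 P₀ K (w.1, τ w) G ∂P := by
    intro n
    have hc : (n : ℝ≥0) < n + 1 := lt_add_one _
    have hSn : S n = Prod.fst ⁻¹' {ω | (ω, (n + 1 : ℝ≥0)) ∈ A ∧ τ (ω, (n + 1 : ℝ≥0)) ≤ n} ∩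
        {w : EnlargedSpace | τ (w.1, (n + 1 : ℝ≥0)) < w.2} := by
      ext w
      exact mem_section_iff hτ hA hc w
    have h := measure_section_eq hP₀ hB hK hK_supp (ρ := fun ω => τ (ω, (n + 1 : ℝ≥0)))
      (A := {ω | (ω, (n + 1 : ℝ≥0)) ∈ A ∧ τ (ω, (n + 1 : ℝ≥0)) ≤ n})
      (isStoppingTime_section hτ hle (n + 1)) (measurableSet_section hτ hle hA hc) hG
    rw [← hSn] at h
    rw [h]
    refine setLIntegral_congr_fun (hSm n) fun w hw => ?_
    have hw' : τ (w.1, (n + 1 : ℝ≥0)) = τ (w.1, w.2) :=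
      stoppingTime_eq_of_lt hτ hw.2.1 (hw.2.2.trans_lt hc)
    simp only [hw']
  have hU : ∀ ν : Measure EnlargedSpace, ν (⋃ n, S n) = ⨆ n, ν (S n) := fun ν =>
    hSmono.measure_iUnion
  have hUm : MeasurableSet (⋃ n, S n) := MeasurableSet.iUnion hSm
  -- Both sides are read as measures of `⋃ n, S n`, the right one with density, so continuity from
  -- below settles the limit.
  rw [hSU, ← Measure.restrict_apply hUm, ← withDensity_apply _ hUm, hU, hU]
  refine iSup_congr fun n => ?_
  rw [Measure.restrict_apply (hSm n), withDensity_apply _ (hSm n), hn n]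

lemma isRegularCondProb_Phat [IsProbabilityMeasure P] (hP₀ : IsWienerMeasure P₀)
    (hB : IsFilteredBrownianMotion enlargedFiltration (fun t w => w.1 t) P)
    (hK : IsRegularCondProb sigmaB P fun w => K w.1) (hK_supp : ∀ ω, K ω {w | w.1 = ω} = 1)
    (hτ : IsStoppingTime enlargedFiltration (fun w => (τ w : WithTop ℝ≥0)))
    (hle : ∀ w, τ w ≤ w.2) :
    IsRegularCondProb hτ.measurableSpace P (Phat P₀ K τ) := by
  have hKm := measurable_of_isRegularCondProb hK
  have hKp : ∀ ω, IsProbabilityMeasure (K ω) := fun ω => hK.isProbabilityMeasure (ω, 0)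
  have hP₀' : IsProbabilityMeasure P₀ := (hP₀.hasLaw ∅).isProbabilityMeasure
  refine IsRegularCondProb.of_measure_inter hτ.measurableSpace_le
    (isProbabilityMeasure_Phat hKm hKp) (measurable_Phat hKm hKp hτ hle) fun A hA G hG => ?_
  have hτm : Measurable τ := hτ.measurable'.untopA
  have hAm : MeasurableSet A := hτ.measurableSpace_le _ hA
  have hltm : MeasurableSet {w : EnlargedSpace | τ w < w.2} := measurableSet_lt hτm measurable_snd
  -- Since `τ ≤ T`, the past of `τ` lies in that of `T`, so the identity at `T` covers this part of
  -- `A`.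
  have heq : MeasurableSet[sigmaT] (A \ {w | τ w < w.2}) := by
    have h1 : MeasurableSet[sigmaT] A := IsStoppingTime.measurableSpace_mono hτ isStoppingTime_T
      (fun w => WithTop.coe_le_coe.2 (hle w)) A hA
    have h2 := IsStoppingTime.measurableSet_le_stopping_time isStoppingTime_T hτ
    convert h1.inter h2 using 1
    ext w
    simp only [Set.mem_sdiff, Set.mem_inter_iff, Set.mem_ofPred_eq, WithTop.coe_le_coe, not_lt]
  have hlt := measure_inter_lt_eq hP₀ hB hK hK_supp hτ hle hA hG
  have hge := measure_inter_sigmaT hP₀ hB heq hG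
  rw [← lintegral_inter_add_sdiff _ A hltm, ← measure_inter_add_sdiff (A ∩ G) hltm]
  congr 1
  · rw [Set.inter_right_comm, hlt]
    refine setLIntegral_congr_fun (hAm.inter hltm) fun w hw => ?_
    simp only [Phat, if_pos (show τ w < w.2 from hw.2)]
  · rw [show (A ∩ G) \ {w | τ w < w.2} = (A \ {w | τ w < w.2}) ∩ G by
      ext w; simp only [Set.mem_sdiff, Set.mem_inter_iff]; tauto, hge]
    refine setLIntegral_congr_fun (hAm.diff hltm) fun w hw => ?_
    have hw' : ¬ τ w < w.2 := hw.2
    rw [Phat, if_neg hw', (hle w).antisymm (not_lt.1 hw')]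

end Phat

end SkorokhodEmbedding

theorem mainTheorem5
    (P₀ : Measure SkorokhodEmbedding.PathSpace) (hP₀ : SkorokhodEmbedding.IsWienerMeasure P₀)
    (μ : Measure ℝ) (hμ : IsProbabilityMeasure μ) (hμ_int : Integrable (fun x : ℝ => x) μ)
    (hμ_zero : ∫ x, x ∂μ = 0)
    (ξ : SkorokhodEmbedding.EnlargedSpace → ℝ) (hξ : Measurable ξ)
    (hξ_na : SkorokhodEmbedding.NonAnticipative ξ)
    (Pstar : Measure SkorokhodEmbedding.EnlargedSpace)
    (hPstar : SkorokhodEmbedding.IsEmbedding μ Pstar)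
    (K : SkorokhodEmbedding.PathSpace → Measure SkorokhodEmbedding.EnlargedSpace)
    (hK : SkorokhodEmbedding.IsRegularCondProb SkorokhodEmbedding.sigmaB Pstar (fun w => K w.1))
    (hK_supp : ∀ ω, K ω {w | w.1 = ω} = 1) :
    MeasurableSet[SkorokhodEmbedding.sigmaT.prod SkorokhodEmbedding.sigmaT]
      (SkorokhodEmbedding.SGstar ξ P₀ K) ∧
    ∀ (τ : SkorokhodEmbedding.EnlargedSpace → ℝ≥0)
      (hτ : IsStoppingTime SkorokhodEmbedding.enlargedFiltration
        (fun w => (τ w : WithTop ℝ≥0))),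
      (∀ w, τ w ≤ w.2) →
      (∃ τ₀ : SkorokhodEmbedding.PathSpace → WithTop ℝ≥0,
        IsStoppingTime SkorokhodEmbedding.PathSpace.filtration τ₀ ∧
        ∀ w, (τ w : WithTop ℝ≥0) = min (τ₀ w.1) (w.2 : WithTop ℝ≥0)) ∧
      SkorokhodEmbedding.IsRegularCondProb hτ.measurableSpace Pstar
        (SkorokhodEmbedding.Phat P₀ K τ) := by
  have hP₀' : IsProbabilityMeasure P₀ := (hP₀.hasLaw ∅).isProbabilityMeasure
  have hPstar' : IsProbabilityMeasure Pstar := hPstar.isProbabilityMeasure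
  refine ⟨SkorokhodEmbedding.measurableSet_SGstar_sigmaT hξ hξ_na
    (SkorokhodEmbedding.measurable_of_isRegularCondProb hK)
    (fun ω => hK.isProbabilityMeasure (ω, 0)), fun τ hτ hle => ⟨?_, ?_⟩⟩
  · exact SkorokhodEmbedding.exists_stoppingTime_eq_min hτ hle
  · exact SkorokhodEmbedding.isRegularCondProb_Phat hP₀ hPstar.brownian hK hK_supp hτ hle
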